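/- **Setting.** Let $\mathbb{Q}^\pi = \mathbb{Q}(e^{\pi\xi} \mid \xi \in \mathbb{Q}(i)) \subset \mathbb{C}$ be the Gelfond field (it contains all roots of unity and all $\sqrt q$ for $q \in \mathbb{Q}_{>0}$). Let $\mathbb{T}_{\mathbb{Q}} \subset \mathbb{Q}^\pi$ be the group of roots of unity, let $G = \Gamma = \mathbb{Q}$ (positions and momenta) with pairing $\langle \xi, x\rangle = e^{2\pi i x\xi} \in \mathbb{T}_{\mathbb{Q}}$, and let $H$ be the rational Heisenberg group: the set of all $c\,(x,\xi)$ with $c \in \mathbb{T}_{\mathbb{Q}}$, $x \in G$, $\xi \in \Gamma$, with multiplication $$c\,(x,\xi)\cdot c'\,(x',\xi') = c c' \langle \xi, x'\rangle\,(x+x', \xi+\xi').$$ We identify $\mathbb{T}_{\mathbb{Q}}$, $G$, $\Gamma$ with the subgroups of elements $c\,(0,0)$, $(x,0)$, $(0,\xi)$, respectively. A *Heisenberg twain algebra* is a $\mathbb{Q}^\pi$-vector space $A$ with two commutative, associative, bilinear products $\star$ and $\cdot$ (not necessarily unital) and a $\mathbb{Q}^\pi$-linear action of $H$ in which $c \in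 \mathbb{T}_{\mathbb{Q}}$ acts as multiplication by the scalar $c$, such that for all $a, b \in A$: * $h(a \star b) = (ha)\star b$ for $h \in \mathbb{T}_{\mathbb{Q}}G$, and $\xi(a\star b) = (\xi a)\star(\xi b)$ for $\xi \in \Gamma$; * $h(a\cdot b) = (ha)\cdot b$ for $h \in \mathbb{T}_{\mathbb{Q}}\Gamma$, and $x(a\cdot b) = (xa)\cdot(xb)$ for $x\in G$. Isomorphisms of Heisenberg twain algebras are the $H$-equivariant $\mathbb{Q}^\pi$-linear bijections that respect both products. A *twain Heisenberg ideal* is a linear subspace that is an ideal for both products and stable under $H$; $\langle R\rangle$ denotes the smallest one containing the set $R$. *The rational Gaussian singlet* $\mathcal{G}$ is the $\mathbb{Q}^\pi$-linear span of the functions $e_\alpha\, g_{\mu,\rho}\colon \mathbb{R}\to\mathbb{C}$ with $\alpha,\mu,\rho\in\mathbb{Q}$, $\rho>0$, where $$e_\alpha(y) = e^{2\pi i\alpha y}, \qquad g_{\mu,\rho}(y) = e^{-\pi\rho(y-\mu)^2}.$$ It is a Heisenberg twain algebra under the convolution $(s\star t)(y)=\int_{\mathbb{R}} s(z)\,t(y-z)\,dz$,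 the pointwise product, and the action of $H$ by translations $(x\,s)(y)=s(y-x)$ for $x\in G$ and modulations $(\xi\, s)(y)=e^{2\pi i\xi y}s(y)$ for $\xi\in\Gamma$. Write $g = g_{0,1}$ for the unit Gaussian. Let $\mathfrak{T}(u)$ be the free Heisenberg twain algebra on one generator $u$. Write $a^n$ and $a^{\star n}$ ($n\geq 1$) for the powers with respect to $\cdot$ and $\star$. For $\rho\in\mathbb{Q}_{>0}$, written $\rho=n/m$ in lowest terms with $n, m\ge 1$, put $u_\rho=\sqrt{m\,n^{m-1}}\;(u^n)^{\star m}\in\mathfrak{T}(u)$. For $\rho,\rho'>0$ put $\rho\boxplus\rho'=\rho\rho'/(\rho+\rho')$. Let $\mathcal{R}_u\subset\mathfrak{T}(u)$ consist of the differences of the left and right sides of the following equations. 1. Convolution laws, for all $\alpha,\alpha'\in\Gamma$ and $\rho,\rho'\in\mathbb{Q}_{>0}$: $$(\alpha\, u_\rho)\star(\alpha'\, u_{\rho'}) = \frac{e^{-\pi(\alpha-\alpha')^2/(\rho+\rho')}}{\sqrt{\rho+\rho'}}\;\frac{\alpha\rho'+\alpha'\rho}{\rho+\rho'}\; u_{\rho\boxplus\rho'},$$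 where the fraction $\frac{\alpha\rho'+\alpha'\rho}{\rho+\rho'}$ acts as an element of $\Gamma$. 2. Pointwise product laws, for all $\mu,\mu'\in G$ and $\rho,\rho'\in\mathbb{Q}_{>0}$: $$(\mu\, u_\rho)\cdot(\mu'\, u_{\rho'}) = e^{-\pi(\rho\boxplus\rho')(\mu-\mu')^2}\;\frac{\mu\rho+\mu'\rho'}{\rho+\rho'}\; u_{\rho+\rho'},$$ where the fraction $\frac{\mu\rho+\mu'\rho'}{\rho+\rho'}$ acts as an element of $G$. 3. Laws commuting convolution powers with pointwise powers, for all integers $n,m\ge1$: $$(u^{\star m})^n=\sqrt{n^{m-1}/m^{n-1}}\;(u^n)^{\star m}.$$ **Theorem.** There is exactly one isomorphism of Heisenberg twain algebras $\mathcal{G}\cong\mathfrak{T}(u)/\langle\mathcal{R}_u\rangle$ that sends the unit Gaussian $g$ to the class of $u$. -/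

import Mathlib

namespace HeisTwain

/-! ### Dualities and Heisenberg groups -/

/-- A duality `β : Γ × G → T`: a nondegenerate bilinear pairing of abelian groups (`G`, `Γ` written
additively, the torus `T` multiplicatively). -/
structure Duality (Γ G T : Type*) [AddCommGroup Γ] [AddCommGroup G] [CommGroup T] where
  pair : Γ → G → T
  pair_add_left : ∀ ξ ξ' x, pair (ξ + ξ') x = pair ξ x * pair ξ' x
  pair_add_right : ∀ ξ x x', pair ξ (x + x') = pair ξ x * pair ξ x'
  nondeg_left : ∀ ξ, (∀ x, pair ξ x = 1) → ξ = 0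
  nondeg_right : ∀ x, (∀ ξ, pair ξ x = 1) → x = 0

section General

variable {Γ G T : Type*} [AddCommGroup Γ] [AddCommGroup G] [CommGroup T]

theorem Duality.pair_zero_left (β : Duality Γ G T) (x : G) : β.pair 0 x = 1 := by
  have h := β.pair_add_left 0 0 x
  simpa using h

theorem Duality.pair_zero_right (β : Duality Γ G T) (ξ : Γ) : β.pair ξ 0 = 1 := by
  have h := β.pair_add_right ξ 0 0
  simpa using h

theorem Duality.pair_neg_left (β : Duality Γ G T) (ξ : Γ) (x : G) :
    β.pair (-ξ) x = (β.pair ξ x)⁻¹ := by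
  have h := β.pair_add_left (-ξ) ξ x
  rw [neg_add_cancel, β.pair_zero_left] at h
  exact eq_inv_of_mul_eq_one_left h.symm

/-- The Heisenberg group `H(β) = TG ⋊ Γ`. The element `c (x, ξ)` has torus component `c`,
position `x` and momentum `ξ`. -/
@[ext]
structure HeisenbergGroup (β : Duality Γ G T) where
  torus : T
  pos : G
  mom : Γ

namespace HeisenbergGroup

variable {β : Duality Γ G T}

/-- The group law `c (x, ξ) · c' (x', ξ') = c c' ⟨ξ, x'⟩ (x + x', ξ + ξ')`. -/
instance : Group (HeisenbergGroup β) where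
  mul h k := ⟨h.torus * k.torus * β.pair h.mom k.pos, h.pos + k.pos, h.mom + k.mom⟩
  one := ⟨1, 0, 0⟩
  inv h := ⟨h.torus⁻¹ * β.pair h.mom h.pos, -h.pos, -h.mom⟩
  mul_assoc a b c := by
    apply HeisenbergGroup.ext
    · change (a.torus * b.torus * β.pair a.mom b.pos) * c.torus * β.pair (a.mom + b.mom) c.pos
        = a.torus * (b.torus * c.torus * β.pair b.mom c.pos) * β.pair a.mom (b.pos + c.pos)
      rw [β.pair_add_left, β.pair_add_right]
      simp only [mul_assoc, mul_left_comm, mul_comm]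
    · exact add_assoc _ _ _
    · exact add_assoc _ _ _
  one_mul a := by
    apply HeisenbergGroup.ext
    · change 1 * a.torus * β.pair 0 a.pos = a.torus
      rw [β.pair_zero_left, one_mul, mul_one]
    · exact zero_add _
    · exact zero_add _
  mul_one a := by
    apply HeisenbergGroup.ext
    · change a.torus * 1 * β.pair a.mom 0 = a.torus
      rw [β.pair_zero_right, mul_one, mul_one]
    · exact add_zero _
    · exact add_zero _
  inv_mul_cancel a := by
    apply HeisenbergGroup.ext
    · change a.torus⁻¹ * β.pair a.mom a.pos * a.torus * β.pair (-a.mom) a.pos = 1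
      rw [β.pair_neg_left, mul_right_comm, mul_assoc a.torus⁻¹, mul_inv_cancel, mul_one,
        inv_mul_cancel]
    · exact neg_add_cancel _
    · exact neg_add_cancel _

theorem mul_def (h k : HeisenbergGroup β) :
    h * k = ⟨h.torus * k.torus * β.pair h.mom k.pos, h.pos + k.pos, h.mom + k.mom⟩ := rfl

theorem one_def : (1 : HeisenbergGroup β) = ⟨1, 0, 0⟩ := rfl

/-- The embedded torus `T ≤ H(β)`. -/
def ofTorus (c : T) : HeisenbergGroup β := ⟨c, 0, 0⟩

/-- The embedded position group `G ≤ H(β)`. -/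
def ofPos (x : G) : HeisenbergGroup β := ⟨1, x, 0⟩

/-- The embedded momentum group `Γ ≤ H(β)`. -/
def ofMom (ξ : Γ) : HeisenbergGroup β := ⟨1, 0, ξ⟩

end HeisenbergGroup

open HeisenbergGroup

/-! ### Heisenberg twain algebras -/

variable {K : Type*} [CommRing K]

/-- A twain algebra: a `K`-module with two bilinear products, the convolution `conv` and the
pointwise product `ptw`, both commutative and associative (not necessarily unital). -/
structure TwainAlgebra (K A : Type*) [CommRing K] [AddCommGroup A] [Module K A] where
  conv : A →ₗ[K] A →ₗ[K] A
  ptw : A →ₗ[K] A →ₗ[K] A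
  conv_comm : ∀ a b, conv a b = conv b a
  conv_assoc : ∀ a b c, conv (conv a b) c = conv a (conv b c)
  ptw_comm : ∀ a b, ptw a b = ptw b a
  ptw_assoc : ∀ a b c, ptw (ptw a b) c = ptw a (ptw b c)

/-- A Heisenberg module over `β` with torus action `ε : T → K`: a `K`-linear representation of
`H(β)` on which the torus acts through `ε`. -/
structure HeisenbergModule (β : Duality Γ G T) (ε : T →* K)
    (A : Type*) [AddCommGroup A] [Module K A] where
  act : Representation K (HeisenbergGroup β) A
  act_torus : ∀ c a, act (ofTorus c) a = ε c • a

/-- A Heisenberg twain algebra: for the convolution, elements of `TG` are scalars and elements of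
`Γ` are operators; for the pointwise product, elements of `TΓ` are scalars and elements of `G` are
operators. -/
structure HeisenbergTwainAlgebra (β : Duality Γ G T) (ε : T →* K)
    (A : Type*) [AddCommGroup A] [Module K A]
    extends TwainAlgebra K A, HeisenbergModule β ε A where
  conv_scalar : ∀ (c : T) (x : G) (a b : A), act ⟨c, x, 0⟩ (conv a b) = conv (act ⟨c, x, 0⟩ a) b
  conv_operator : ∀ (ξ : Γ) (a b : A),
    act (ofMom ξ) (conv a b) = conv (act (ofMom ξ) a) (act (ofMom ξ) b)
  ptw_scalar : ∀ (c : T) (ξ : Γ) (a b : A), act ⟨c, 0, ξ⟩ (ptw a b) = ptw (act ⟨c, 0, ξ⟩ a) b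
  ptw_operator : ∀ (x : G) (a b : A),
    act (ofPos x) (ptw a b) = ptw (act (ofPos x) a) (act (ofPos x) b)

/-- An isomorphism of Heisenberg twain algebras: an equivariant `K`-linear bijection that respects
both products. -/
structure HeisenbergTwainEquiv {β : Duality Γ G T} {ε : T →* K}
    {A B : Type*} [AddCommGroup A] [Module K A] [AddCommGroup B] [Module K B]
    (𝒜 : HeisenbergTwainAlgebra β ε A) (ℬ : HeisenbergTwainAlgebra β ε B)
    extends A ≃ₗ[K] B where
  map_conv : ∀ a b, toFun (𝒜.conv a b) = ℬ.conv (toFun a) (toFun b)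
  map_ptw : ∀ a b, toFun (𝒜.ptw a b) = ℬ.ptw (toFun a) (toFun b)
  map_act : ∀ h a, toFun (𝒜.act h a) = ℬ.act h (toFun a)

/-! ### Twain Heisenberg ideals and quotients -/

section Ideal

variable {β : Duality Γ G T} {ε : T →* K} {A : Type*} [AddCommGroup A] [Module K A]

/-- Twain Heisenberg ideals: submodules that are ideals for both products and closed under the
Heisenberg action. -/
structure HeisenbergTwainAlgebra.IsIdeal (𝒜 : HeisenbergTwainAlgebra β ε A)
    (I : Submodule K A) : Prop where
  conv_mem : ∀ a, ∀ b ∈ I, 𝒜.conv a b ∈ I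
  ptw_mem : ∀ a, ∀ b ∈ I, 𝒜.ptw a b ∈ I
  act_mem : ∀ h, ∀ b ∈ I, 𝒜.act h b ∈ I

/-- The twain Heisenberg ideal `⟨R⟩` generated by a set `R`: the intersection of all twain
Heisenberg ideals containing `R`. -/
def HeisenbergTwainAlgebra.idealSpan (𝒜 : HeisenbergTwainAlgebra β ε A) (R : Set A) :
    Submodule K A :=
  sInf {I | 𝒜.IsIdeal I ∧ R ⊆ I}

theorem HeisenbergTwainAlgebra.isIdeal_idealSpan (𝒜 : HeisenbergTwainAlgebra β ε A) (R : Set A) :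
    𝒜.IsIdeal (𝒜.idealSpan R) where
  conv_mem a b hb := by
    rw [idealSpan, Submodule.mem_sInf] at hb ⊢
    exact fun I hI => hI.1.conv_mem a b (hb I hI)
  ptw_mem a b hb := by
    rw [idealSpan, Submodule.mem_sInf] at hb ⊢
    exact fun I hI => hI.1.ptw_mem a b (hb I hI)
  act_mem h b hb := by
    rw [idealSpan, Submodule.mem_sInf] at hb ⊢
    exact fun I hI => hI.1.act_mem h b (hb I hI)

/-- A bilinear commutative product for which `I` is an ideal descends to the quotient by `I`. -/
def quotientMul (I : Submodule K A) (m : A →ₗ[K] A →ₗ[K] A) (hc : ∀ a b, m a b = m b a)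
    (hI : ∀ a, ∀ b ∈ I, m a b ∈ I) : (A ⧸ I) →ₗ[K] (A ⧸ I) →ₗ[K] (A ⧸ I) :=
  I.liftQ
    { toFun := fun a => I.mapQ I (m a) (fun b hb => hI a b hb)
      map_add' := fun a b => by
        ext c
        simp
      map_smul' := fun k a => by
        ext c
        simp }
    (fun a ha => by
      rw [LinearMap.mem_ker]
      ext b
      have : m a b ∈ I := by rw [hc]; exact hI b a ha
      simpa using this)

/-- The quotient Heisenberg twain algebra `𝒜 / I`. -/
def HeisenbergTwainAlgebra.quotient (𝒜 : HeisenbergTwainAlgebra β ε A) (I : Submodule K A)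
    (hI : 𝒜.IsIdeal I) : HeisenbergTwainAlgebra β ε (A ⧸ I) where
  conv := quotientMul I 𝒜.conv 𝒜.conv_comm hI.conv_mem
  ptw := quotientMul I 𝒜.ptw 𝒜.ptw_comm hI.ptw_mem
  conv_comm a b := by
    obtain ⟨a, rfl⟩ := I.mkQ_surjective a
    obtain ⟨b, rfl⟩ := I.mkQ_surjective b
    exact congrArg I.mkQ (𝒜.conv_comm a b)
  conv_assoc a b c := by
    obtain ⟨a, rfl⟩ := I.mkQ_surjective a
    obtain ⟨b, rfl⟩ := I.mkQ_surjective b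
    obtain ⟨c, rfl⟩ := I.mkQ_surjective c
    exact congrArg I.mkQ (𝒜.conv_assoc a b c)
  ptw_comm a b := by
    obtain ⟨a, rfl⟩ := I.mkQ_surjective a
    obtain ⟨b, rfl⟩ := I.mkQ_surjective b
    exact congrArg I.mkQ (𝒜.ptw_comm a b)
  ptw_assoc a b c := by
    obtain ⟨a, rfl⟩ := I.mkQ_surjective a
    obtain ⟨b, rfl⟩ := I.mkQ_surjective b
    obtain ⟨c, rfl⟩ := I.mkQ_surjective c
    exact congrArg I.mkQ (𝒜.ptw_assoc a b c)
  act :=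
    { toFun := fun h => I.mapQ I (𝒜.act h) (fun b hb => hI.act_mem h b hb)
      map_one' := by
        ext a
        simp
      map_mul' := fun h k => by
        ext a
        simp }
  act_torus c a := by
    obtain ⟨a, rfl⟩ := I.mkQ_surjective a
    exact congrArg I.mkQ (𝒜.act_torus c a)
  conv_scalar c x a b := by
    obtain ⟨a, rfl⟩ := I.mkQ_surjective a
    obtain ⟨b, rfl⟩ := I.mkQ_surjective b
    exact congrArg I.mkQ (𝒜.conv_scalar c x a b)
  conv_operator ξ a b := by
    obtain ⟨a, rfl⟩ := I.mkQ_surjective a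
    obtain ⟨b, rfl⟩ := I.mkQ_surjective b
    exact congrArg I.mkQ (𝒜.conv_operator ξ a b)
  ptw_scalar c ξ a b := by
    obtain ⟨a, rfl⟩ := I.mkQ_surjective a
    obtain ⟨b, rfl⟩ := I.mkQ_surjective b
    exact congrArg I.mkQ (𝒜.ptw_scalar c ξ a b)
  ptw_operator x a b := by
    obtain ⟨a, rfl⟩ := I.mkQ_surjective a
    obtain ⟨b, rfl⟩ := I.mkQ_surjective b
    exact congrArg I.mkQ (𝒜.ptw_operator x a b)

end Ideal

/-! ### The free Heisenberg twain algebra, as the term algebra modulo the defining laws -/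

/-- Terms over the signature of Heisenberg twain algebras with generators from `X`. -/
inductive Term (β : Duality Γ G T) (K : Type*) (X : Type*)
  | gen : X → Term β K X
  | zero : Term β K X
  | add : Term β K X → Term β K X → Term β K X
  | smul : K → Term β K X → Term β K X
  | act : HeisenbergGroup β → Term β K X → Term β K X
  | conv : Term β K X → Term β K X → Term β K X
  | ptw : Term β K X → Term β K X → Term β K X

/-- The laws of Heisenberg twain algebras, closed under the operations. -/
inductive TermRel (β : Duality Γ G T) (ε : T →* K) (X : Type*) :
    Term β K X → Term β K X → Prop
  | add_congr_left {a a' : Term β K X} (b) : TermRel β ε X a a' →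
      TermRel β ε X (.add a b) (.add a' b)
  | add_congr_right (a) {b b' : Term β K X} : TermRel β ε X b b' →
      TermRel β ε X (.add a b) (.add a b')
  | smul_congr (k) {a a' : Term β K X} : TermRel β ε X a a' →
      TermRel β ε X (.smul k a) (.smul k a')
  | act_congr (h) {a a' : Term β K X} : TermRel β ε X a a' →
      TermRel β ε X (.act h a) (.act h a')
  | conv_congr_left {a a' : Term β K X} (b) : TermRel β ε X a a' →
      TermRel β ε X (.conv a b) (.conv a' b)
  | conv_congr_right (a) {b b' : Term β K X} : TermRel β ε X b b' →
      TermRel β ε X (.conv a b) (.conv a b')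
  | ptw_congr_left {a a' : Term β K X} (b) : TermRel β ε X a a' →
      TermRel β ε X (.ptw a b) (.ptw a' b)
  | ptw_congr_right (a) {b b' : Term β K X} : TermRel β ε X b b' →
      TermRel β ε X (.ptw a b) (.ptw a b')
  | add_assoc (a b c) : TermRel β ε X (.add (.add a b) c) (.add a (.add b c))
  | add_comm (a b) : TermRel β ε X (.add a b) (.add b a)
  | zero_add (a) : TermRel β ε X (.add .zero a) a
  | one_smul (a) : TermRel β ε X (.smul 1 a) a
  | mul_smul (k l a) : TermRel β ε X (.smul (k * l) a) (.smul k (.smul l a))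
  | smul_add (k a b) : TermRel β ε X (.smul k (.add a b)) (.add (.smul k a) (.smul k b))
  | add_smul (k l a) : TermRel β ε X (.smul (k + l) a) (.add (.smul k a) (.smul l a))
  | zero_smul (a) : TermRel β ε X (.smul 0 a) .zero
  | act_one (a) : TermRel β ε X (.act 1 a) a
  | act_mul (h h' a) : TermRel β ε X (.act (h * h') a) (.act h (.act h' a))
  | act_add (h a b) : TermRel β ε X (.act h (.add a b)) (.add (.act h a) (.act h b))
  | act_smul (h k a) : TermRel β ε X (.act h (.smul k a)) (.smul k (.act h a))
  | act_torus (c a) : TermRel β ε X (.act (ofTorus c) a) (.smul (ε c) a)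
  | conv_add (a b c) : TermRel β ε X (.conv (.add a b) c) (.add (.conv a c) (.conv b c))
  | conv_smul (k a b) : TermRel β ε X (.conv (.smul k a) b) (.smul k (.conv a b))
  | conv_comm (a b) : TermRel β ε X (.conv a b) (.conv b a)
  | conv_assoc (a b c) : TermRel β ε X (.conv (.conv a b) c) (.conv a (.conv b c))
  | ptw_add (a b c) : TermRel β ε X (.ptw (.add a b) c) (.add (.ptw a c) (.ptw b c))
  | ptw_smul (k a b) : TermRel β ε X (.ptw (.smul k a) b) (.smul k (.ptw a b))
  | ptw_comm (a b) : TermRel β ε X (.ptw a b) (.ptw b a)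
  | ptw_assoc (a b c) : TermRel β ε X (.ptw (.ptw a b) c) (.ptw a (.ptw b c))
  | conv_scalar (c x a b) :
      TermRel β ε X (.act ⟨c, x, 0⟩ (.conv a b)) (.conv (.act ⟨c, x, 0⟩ a) b)
  | conv_operator (ξ a b) : TermRel β ε X (.act (ofMom ξ) (.conv a b))
      (.conv (.act (ofMom ξ) a) (.act (ofMom ξ) b))
  | ptw_scalar (c ξ a b) :
      TermRel β ε X (.act ⟨c, 0, ξ⟩ (.ptw a b)) (.ptw (.act ⟨c, 0, ξ⟩ a) b)
  | ptw_operator (x a b) : TermRel β ε X (.act (ofPos x) (.ptw a b))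
      (.ptw (.act (ofPos x) a) (.act (ofPos x) b))

/-- The carrier of the free Heisenberg twain algebra `𝔗(X)` over the set `X`. -/
def FreeTwain (β : Duality Γ G T) (ε : T →* K) (X : Type*) : Type _ := Quot (TermRel β ε X)

namespace FreeTwain

variable (β : Duality Γ G T) (ε : T →* K) (X : Type*)

instance : Add (FreeTwain β ε X) where
  add := Quot.map₂ Term.add (fun a _ _ h => .add_congr_right a h) (fun _ _ b h => .add_congr_left b h)

instance : Zero (FreeTwain β ε X) where
  zero := Quot.mk _ .zero

instance : AddCommMonoid (FreeTwain β ε X) where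
  add_assoc := by
    rintro ⟨a⟩ ⟨b⟩ ⟨c⟩
    exact Quot.sound (.add_assoc a b c)
  add_comm := by
    rintro ⟨a⟩ ⟨b⟩
    exact Quot.sound (.add_comm a b)
  zero_add := by
    rintro ⟨a⟩
    exact Quot.sound (.zero_add a)
  add_zero := by
    rintro ⟨a⟩
    exact (Quot.sound (.add_comm a .zero)).trans (Quot.sound (.zero_add a))
  nsmul := nsmulRec

instance : Module K (FreeTwain β ε X) where
  smul k := Quot.map (Term.smul k) (fun _ _ h => .smul_congr k h)
  one_smul := by
    rintro ⟨a⟩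
    exact Quot.sound (.one_smul a)
  mul_smul k l := by
    rintro ⟨a⟩
    exact Quot.sound (.mul_smul k l a)
  smul_add k := by
    rintro ⟨a⟩ ⟨b⟩
    exact Quot.sound (.smul_add k a b)
  add_smul k l := by
    rintro ⟨a⟩
    exact Quot.sound (.add_smul k l a)
  zero_smul := by
    rintro ⟨a⟩
    exact Quot.sound (.zero_smul a)
  smul_zero k := by
    have h : ∀ l : K, Quot.mk (TermRel β ε X) (.smul l (.smul 0 .zero))
        = Quot.mk (TermRel β ε X) (.smul l .zero) :=
      fun l => Quot.sound (.smul_congr l (.zero_smul .zero))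
    refine (h k).symm.trans ?_
    refine (Quot.sound (.mul_smul k 0 .zero)).symm.trans ?_
    rw [mul_zero]
    exact Quot.sound (.zero_smul .zero)

instance : AddCommGroup (FreeTwain β ε X) := Module.addCommMonoidToAddCommGroup K

variable {X}

/-- The embedding of the generators. -/
def gen (x : X) : FreeTwain β ε X := Quot.mk _ (.gen x)

variable (X)

/-- The free Heisenberg twain algebra `𝔗(X)`. -/
def algebra : HeisenbergTwainAlgebra β ε (FreeTwain β ε X) where
  conv := LinearMap.mk₂ K
    (Quot.map₂ Term.conv (fun a _ _ h => .conv_congr_right a h) (fun _ _ b h => .conv_congr_left b h))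
    (by
      rintro ⟨a⟩ ⟨b⟩ ⟨c⟩
      exact Quot.sound (.conv_add a b c))
    (by
      rintro k ⟨a⟩ ⟨b⟩
      exact Quot.sound (.conv_smul k a b))
    (by
      rintro ⟨a⟩ ⟨b⟩ ⟨c⟩
      refine (Quot.sound (.conv_comm a (.add b c))).trans ((Quot.sound (.conv_add b c a)).trans ?_)
      exact (Quot.sound (.add_congr_left _ (.conv_comm b a))).trans
        (Quot.sound (.add_congr_right _ (.conv_comm c a))))
    (by
      rintro k ⟨a⟩ ⟨b⟩
      refine (Quot.sound (.conv_comm a (.smul k b))).trans ((Quot.sound (.conv_smul k b a)).trans ?_)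
      exact Quot.sound (.smul_congr k (.conv_comm b a)))
  ptw := LinearMap.mk₂ K
    (Quot.map₂ Term.ptw (fun a _ _ h => .ptw_congr_right a h) (fun _ _ b h => .ptw_congr_left b h))
    (by
      rintro ⟨a⟩ ⟨b⟩ ⟨c⟩
      exact Quot.sound (.ptw_add a b c))
    (by
      rintro k ⟨a⟩ ⟨b⟩
      exact Quot.sound (.ptw_smul k a b))
    (by
      rintro ⟨a⟩ ⟨b⟩ ⟨c⟩
      refine (Quot.sound (.ptw_comm a (.add b c))).trans ((Quot.sound (.ptw_add b c a)).trans ?_)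
      exact (Quot.sound (.add_congr_left _ (.ptw_comm b a))).trans
        (Quot.sound (.add_congr_right _ (.ptw_comm c a))))
    (by
      rintro k ⟨a⟩ ⟨b⟩
      refine (Quot.sound (.ptw_comm a (.smul k b))).trans ((Quot.sound (.ptw_smul k b a)).trans ?_)
      exact Quot.sound (.smul_congr k (.ptw_comm b a)))
  conv_comm := by
    rintro ⟨a⟩ ⟨b⟩
    exact Quot.sound (.conv_comm a b)
  conv_assoc := by
    rintro ⟨a⟩ ⟨b⟩ ⟨c⟩
    exact Quot.sound (.conv_assoc a b c)
  ptw_comm := by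
    rintro ⟨a⟩ ⟨b⟩
    exact Quot.sound (.ptw_comm a b)
  ptw_assoc := by
    rintro ⟨a⟩ ⟨b⟩ ⟨c⟩
    exact Quot.sound (.ptw_assoc a b c)
  act :=
    { toFun := fun h =>
        { toFun := Quot.map (Term.act h) (fun _ _ r => .act_congr h r)
          map_add' := by
            rintro ⟨a⟩ ⟨b⟩
            exact Quot.sound (.act_add h a b)
          map_smul' := by
            rintro k ⟨a⟩
            exact Quot.sound (.act_smul h k a) }
      map_one' := by
        apply LinearMap.ext
        rintro ⟨a⟩
        exact Quot.sound (.act_one a)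
      map_mul' := fun h k => by
        apply LinearMap.ext
        rintro ⟨a⟩
        exact Quot.sound (.act_mul h k a) }
  act_torus := by
    rintro c ⟨a⟩
    exact Quot.sound (.act_torus c a)
  conv_scalar := by
    rintro c x ⟨a⟩ ⟨b⟩
    exact Quot.sound (.conv_scalar c x a b)
  conv_operator := by
    rintro ξ ⟨a⟩ ⟨b⟩
    exact Quot.sound (.conv_operator ξ a b)
  ptw_scalar := by
    rintro c ξ ⟨a⟩ ⟨b⟩
    exact Quot.sound (.ptw_scalar c ξ a b)
  ptw_operator := by
    rintro x ⟨a⟩ ⟨b⟩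
    exact Quot.sound (.ptw_operator x a b)

end FreeTwain

end General

/-! ### The Gelfond field -/

noncomputable section Gaussians

open MeasureTheory HeisenbergGroup

/-- The Gelfond field `ℚ^π = ℚ(e^{πξ} | ξ ∈ ℚ(i))`. -/
def gelfondField : IntermediateField ℚ ℂ :=
  IntermediateField.adjoin ℚ
    {z | ∃ a b : ℚ, z = Complex.exp (Real.pi * ((a : ℂ) + (b : ℂ) * Complex.I))}

theorem exp_mem_gelfondField (a b : ℚ) :
    Complex.exp (Real.pi * ((a : ℂ) + (b : ℂ) * Complex.I)) ∈ gelfondField :=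
  IntermediateField.subset_adjoin _ _ ⟨a, b, rfl⟩

theorem I_mem_gelfondField : Complex.I ∈ gelfondField := by
  have h := exp_mem_gelfondField 0 (1 / 2)
  have h2 : (Real.pi : ℂ) * (((0 : ℚ) : ℂ) + (((1 / 2 : ℚ)) : ℂ) * Complex.I)
      = Real.pi / 2 * Complex.I := by
    push_cast
    ring
  rwa [h2, Complex.exp_pi_div_two_mul_I] at h

theorem rootOfUnity_mem_gelfondField {z : ℂ} {n : ℕ} (hn : 0 < n) (hz : z ^ n = 1) :
    z ∈ gelfondField := by
  have : NeZero n := ⟨hn.ne'⟩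
  have hz0 : z ≠ 0 := by
    rintro rfl
    rw [zero_pow hn.ne'] at hz
    exact zero_ne_one hz
  obtain ⟨i, -, hi⟩ := (Complex.mem_rootsOfUnity n (Units.mk0 z hz0)).1 (by
    rw [mem_rootsOfUnity]
    ext
    simpa using hz)
  have h := exp_mem_gelfondField 0 (2 * i / n)
  have h2 : (Real.pi : ℂ) * (((0 : ℚ) : ℂ) + (((2 * i / n : ℚ)) : ℂ) * Complex.I)
      = 2 * Real.pi * Complex.I * (i / n) := by
    push_cast
    ring
  rw [h2, hi] at h
  exact h

theorem sqrt_mem_of_sq {x : ℝ} (hx : 0 ≤ x) {w : ℂ} (hw : w ∈ gelfondField)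
    (h : w ^ 2 = (x : ℂ)) : ((Real.sqrt x : ℝ) : ℂ) ∈ gelfondField := by
  have h2 : ((Real.sqrt x : ℝ) : ℂ) ^ 2 = w ^ 2 := by
    rw [h, ← Complex.ofReal_pow, Real.sq_sqrt hx]
  rcases sq_eq_sq_iff_eq_or_eq_neg.1 h2 with h3 | h3
  · rw [h3]
    exact hw
  · rw [h3]
    exact neg_mem hw

theorem sqrt_prime_mem_gelfondField (p : ℕ) (hp : p.Prime) :
    ((Real.sqrt (p : ℝ) : ℝ) : ℂ) ∈ gelfondField := by
  rcases hp.eq_two_or_odd' with rfl | hodd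
  · have h8 : (Complex.exp (Real.pi * (((0 : ℚ) : ℂ) + ((1 / 4 : ℚ) : ℂ) * Complex.I))) ^ 2
        = Complex.I := by
      have h9 : ((2 : ℕ) : ℂ) * (Real.pi * (((0 : ℚ) : ℂ) + ((1 / 4 : ℚ) : ℂ) * Complex.I))
          = Real.pi / 2 * Complex.I := by
        push_cast
        ring
      rw [← Complex.exp_nat_mul, h9, Complex.exp_pi_div_two_mul_I]
    have hI := I_mem_gelfondField
    refine sqrt_mem_of_sq (by positivity)
      (w := Complex.exp (Real.pi * (((0 : ℚ) : ℂ) + ((1 / 4 : ℚ) : ℂ) * Complex.I))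
        * (1 - Complex.I)) (mul_mem (exp_mem_gelfondField _ _) (sub_mem (one_mem _) hI)) ?_
    rw [mul_pow, h8]
    push_cast
    linear_combination (-2 + Complex.I) * Complex.I_sq
  · have : Fact p.Prime := ⟨hp⟩
    have hp2 : ringChar (ZMod p) ≠ 2 := by
      rw [ZMod.ringChar_zmod_n]
      rintro rfl
      exact absurd hodd (by decide)
    set χ : MulChar (ZMod p) ℂ := (quadraticChar (ZMod p)).ringHomComp (Int.castRingHom ℂ) with hχ
    have hχ1 : χ ≠ 1 :=
      (MulChar.ringHomComp_ne_one_iff (RingHom.injective_int _)).2 (quadraticChar_ne_one hp2)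
    have hχ2 : χ.IsQuadratic := (quadraticChar_isQuadratic (ZMod p)).comp _
    have hsq := gaussSum_sq hχ1 hχ2 (ZMod.isPrimitive_stdAddChar p)
    rw [ZMod.card] at hsq
    have hmem : gaussSum χ (ZMod.stdAddChar (N := p)) ∈ gelfondField := by
      rw [gaussSum]
      refine sum_mem fun a _ => mul_mem ?_ ?_
      · rw [hχ, MulChar.ringHomComp_apply]
        exact intCast_mem gelfondField _
      · refine rootOfUnity_mem_gelfondField hp.pos ?_
        rw [← AddChar.map_nsmul_eq_pow]
        simp
    rcases hχ2 (-1) with h0 | h1 | h1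
    · exfalso
      have hu : IsUnit (χ (-1)) := (isUnit_one.neg).map χ
      rw [h0] at hu
      exact not_isUnit_zero hu
    · refine sqrt_mem_of_sq (by positivity) hmem ?_
      rw [hsq, h1]
      simp
    · refine sqrt_mem_of_sq (by positivity) (mul_mem I_mem_gelfondField hmem) ?_
      rw [mul_pow, hsq, h1, Complex.I_sq]
      simp

theorem sqrt_nat_mem_gelfondField (n : ℕ) : ((Real.sqrt (n : ℝ) : ℝ) : ℂ) ∈ gelfondField := by
  induction n using Nat.recOnMul with
  | zero => simp
  | one => simp
  | prime p hp => exact sqrt_prime_mem_gelfondField p hp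
  | mul a b ha hb =>
    rw [Nat.cast_mul, Real.sqrt_mul (Nat.cast_nonneg a), Complex.ofReal_mul]
    exact mul_mem ha hb

theorem sqrt_mem_gelfondField (q : ℚ) : ((Real.sqrt (q : ℝ) : ℝ) : ℂ) ∈ gelfondField := by
  rcases le_or_gt q 0 with hq | hq
  · rw [Real.sqrt_eq_zero_of_nonpos (by exact_mod_cast hq)]
    simp
  · have h : (q : ℝ) = (q.num.toNat : ℝ) / (q.den : ℝ) := by
      have hn : ((q.num.toNat : ℕ) : ℤ) = q.num := Int.toNat_of_nonneg (Rat.num_nonneg.2 hq.le)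
      have hn' : ((q.num.toNat : ℕ) : ℝ) = (q.num : ℝ) := by exact_mod_cast hn
      rw [hn']
      exact Rat.cast_def q
    rw [h, Real.sqrt_div (Nat.cast_nonneg _), Complex.ofReal_div]
    exact div_mem (sqrt_nat_mem_gelfondField _) (sqrt_nat_mem_gelfondField _)

/-- The element `√q` of the Gelfond field, for a rational number `q ≥ 0`. -/
def gelfondSqrt (q : ℚ) : gelfondField := ⟨((Real.sqrt (q : ℝ) : ℝ) : ℂ), sqrt_mem_gelfondField q⟩

/-- The element `e^{πq}` of the Gelfond field, for a rational number `q`. -/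
def gelfondExp (q : ℚ) : gelfondField :=
  ⟨Complex.exp (Real.pi * (q : ℂ)), by
    have h := exp_mem_gelfondField q 0
    have h2 : (Real.pi : ℂ) * ((q : ℂ) + ((0 : ℚ) : ℂ) * Complex.I) = Real.pi * (q : ℂ) := by
      push_cast
      ring
    rwa [h2] at h⟩

/-! ### The rational Heisenberg group -/

/-- The rational torus `𝕋_ℚ`: the torsion subgroup of the unit circle. -/
abbrev RationalTorus : Type := CommGroup.torsion Circle

theorem circle_exp_rat_mem_torsion (q : ℚ) :
    Circle.exp (2 * Real.pi * (q : ℝ)) ∈ CommGroup.torsion Circle := by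
  rw [CommGroup.mem_torsion, isOfFinOrder_iff_pow_eq_one]
  refine ⟨q.den, q.pos, ?_⟩
  rw [← Circle.exp_nsmul]
  have h : q.den • (2 * Real.pi * (q : ℝ)) = (q.num : ℝ) * (2 * Real.pi) := by
    have h1 : (q : ℝ) * (q.den : ℝ) = (q.num : ℝ) := by exact_mod_cast Rat.mul_den_eq_num q
    rw [nsmul_eq_mul, ← h1]
    ring
  rw [h]
  ext
  rw [Circle.coe_exp, Circle.coe_one, Complex.exp_eq_one_iff]
  refine ⟨q.num, ?_⟩
  push_cast
  ring

/-- The rational character `q ↦ e^{2πiq}`. -/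
def ratChar (q : ℚ) : RationalTorus :=
  ⟨Circle.exp (2 * Real.pi * (q : ℝ)), circle_exp_rat_mem_torsion q⟩

theorem coe_ratChar (q : ℚ) :
    (((ratChar q : RationalTorus) : Circle) : ℂ) = Complex.exp (2 * Real.pi * Complex.I * (q : ℂ)) := by
  change ((Circle.exp (2 * Real.pi * (q : ℝ)) : Circle) : ℂ) = _
  rw [Circle.coe_exp]
  congr 1
  push_cast
  ring

theorem ratChar_add (p q : ℚ) : ratChar (p + q) = ratChar p * ratChar q := by
  apply Subtype.ext
  apply Subtype.ext
  change (((ratChar (p + q) : RationalTorus) : Circle) : ℂ)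
    = (((ratChar p : RationalTorus) : Circle) : ℂ) * (((ratChar q : RationalTorus) : Circle) : ℂ)
  rw [coe_ratChar, coe_ratChar, coe_ratChar, ← Complex.exp_add]
  congr 1
  push_cast
  ring

theorem ratChar_half_ne_one : ratChar (1 / 2) ≠ 1 := by
  intro h
  have h2 : (((ratChar (1 / 2) : RationalTorus) : Circle) : ℂ) = 1 := by
    rw [h]
    rfl
  rw [coe_ratChar] at h2
  have h3 : 2 * (Real.pi : ℂ) * Complex.I * (((1 / 2 : ℚ)) : ℂ) = Real.pi * Complex.I := by
    push_cast
    ring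
  rw [h3, Complex.exp_pi_mul_I] at h2
  norm_num at h2

/-- The rational vector duality `β_ℚ : ℚ × ℚ → 𝕋_ℚ`, `⟨ξ, x⟩ = e^{2πixξ}`. -/
def ratDuality : Duality ℚ ℚ RationalTorus where
  pair ξ x := ratChar (x * ξ)
  pair_add_left ξ ξ' x := by rw [mul_add, ratChar_add]
  pair_add_right ξ x x' := by rw [add_mul, ratChar_add]
  nondeg_left ξ h := by
    by_contra hξ
    have := h (1 / 2 / ξ)
    rw [div_mul_cancel₀ _ hξ] at this
    exact ratChar_half_ne_one this
  nondeg_right x h := by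
    by_contra hx
    have := h (1 / 2 / x)
    rw [mul_div_cancel₀ _ hx] at this
    exact ratChar_half_ne_one this

/-- The torus action `𝕋_ℚ ↪ ℚ^π`. -/
def ratTorusAction : RationalTorus →* gelfondField where
  toFun c := ⟨((c : Circle) : ℂ), by
    obtain ⟨n, hn, h⟩ := isOfFinOrder_iff_pow_eq_one.1 c.2
    refine rootOfUnity_mem_gelfondField hn ?_
    rw [← Circle.coe_pow, h, Circle.coe_one]⟩
  map_one' := rfl
  map_mul' _ _ := rfl

/-! ### The rational Gaussian closure -/

/-- The oscillating exponential `e_α(x) = e^{2πiαx}`. -/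
def osc (α : ℚ) : ℝ → ℂ := fun x => Complex.exp (2 * Real.pi * Complex.I * (α : ℂ) * (x : ℂ))

/-- The Gaussian `g_{μ,ρ}(x) = e^{-πρ(x-μ)²}`. -/
def gaussian (μ ρ : ℚ) : ℝ → ℂ :=
  fun x => Complex.exp (-(Real.pi * (ρ : ℂ) * ((x : ℂ) - (μ : ℂ)) ^ 2))

/-- The rational Gaussian closure: the `ℚ^π`-linear span of all `e_α g_{μ,ρ}` with rational
`α, μ, ρ` and `ρ > 0`. -/
def gaussianClosure : Submodule gelfondField (ℝ → ℂ) :=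
  Submodule.span gelfondField {f | ∃ α μ ρ : ℚ, 0 < ρ ∧ f = osc α * gaussian μ ρ}

/-- The action of the rational Heisenberg group on functions `ℝ → ℂ`: positions translate by
`(x • s)(y) = s(y - x)`, momenta modulate by `(ξ • s)(y) = e^{2πiξy} s(y)`, and the torus acts by
scalar multiplication. -/
def heisenbergAction :
    Representation gelfondField (HeisenbergGroup ratDuality) (ℝ → ℂ) where
  toFun h :=
    { toFun := fun s y => ((h.torus : Circle) : ℂ) * (osc h.mom (y - (h.pos : ℝ)) * s (y - (h.pos : ℝ)))
      map_add' := fun s t => by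
        funext y
        simp only [Pi.add_apply]
        ring
      map_smul' := fun k s => by
        funext y
        change ((h.torus : Circle) : ℂ) * (osc h.mom (y - (h.pos : ℝ)) * ((k : ℂ) * s (y - (h.pos : ℝ))))
          = (k : ℂ) * (((h.torus : Circle) : ℂ)
            * (osc h.mom (y - (h.pos : ℝ)) * s (y - (h.pos : ℝ))))
        ring }
  map_one' := by
    apply LinearMap.ext
    intro s
    funext y
    change (((1 : RationalTorus) : Circle) : ℂ) * (osc 0 (y - ((0 : ℚ) : ℝ)) * s (y - ((0 : ℚ) : ℝ)))
      = s y
    simp [osc]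
  map_mul' h k := by
    apply LinearMap.ext
    intro s
    funext y
    change ((h.torus : Circle) : ℂ) * ((k.torus : Circle) : ℂ) *
        (((ratChar (k.pos * h.mom) : RationalTorus) : Circle) : ℂ)
        * (osc (h.mom + k.mom) (y - ((h.pos + k.pos : ℚ) : ℝ)) * s (y - ((h.pos + k.pos : ℚ) : ℝ)))
      = ((h.torus : Circle) : ℂ) * (osc h.mom (y - (h.pos : ℝ)) *
        (((k.torus : Circle) : ℂ) * (osc k.mom (y - (h.pos : ℝ) - (k.pos : ℝ))
          * s (y - (h.pos : ℝ) - (k.pos : ℝ)))))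
    have h1 : y - ((h.pos + k.pos : ℚ) : ℝ) = y - (h.pos : ℝ) - (k.pos : ℝ) := by
      push_cast
      ring
    have h2 : (((ratChar (k.pos * h.mom) : RationalTorus) : Circle) : ℂ)
        * osc (h.mom + k.mom) (y - (h.pos : ℝ) - (k.pos : ℝ))
        = osc h.mom (y - (h.pos : ℝ)) * osc k.mom (y - (h.pos : ℝ) - (k.pos : ℝ)) := by
      rw [coe_ratChar, osc, osc, osc, ← Complex.exp_add, ← Complex.exp_add]
      congr 1
      push_cast
      ring
    rw [h1]
    linear_combination ((h.torus : Circle) : ℂ) * ((k.torus : Circle) : ℂ)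
      * s (y - (h.pos : ℝ) - (k.pos : ℝ)) * h2

theorem heisenbergAction_apply (h : HeisenbergGroup ratDuality) (s : ℝ → ℂ) (y : ℝ) :
    heisenbergAction h s y
      = ((h.torus : Circle) : ℂ) * (osc h.mom (y - (h.pos : ℝ)) * s (y - (h.pos : ℝ))) := rfl

/-- Convolution of functions on the real line. -/
def realConv (f g : ℝ → ℂ) : ℝ → ℂ := convolution f g (ContinuousLinearMap.mul ℂ ℂ) volume

theorem realConv_apply (f g : ℝ → ℂ) (x : ℝ) : realConv f g x = ∫ t, f t * g (x - t) :=
  convolution_mul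

theorem osc_mul_gaussian_mem {α μ ρ : ℚ} (hρ : 0 < ρ) :
    osc α * gaussian μ ρ ∈ gaussianClosure :=
  Submodule.subset_span ⟨α, μ, ρ, hρ, rfl⟩

theorem smul_osc_mul_gaussian_mem {c : ℂ} (hc : c ∈ gelfondField) {α μ ρ : ℚ} (hρ : 0 < ρ) :
    c • (osc α * gaussian μ ρ) ∈ gaussianClosure :=
  gaussianClosure.smul_mem (⟨c, hc⟩ : gelfondField) (osc_mul_gaussian_mem hρ)

theorem osc_mul_gaussian_apply (α μ ρ : ℚ) (x : ℝ) :
    (osc α * gaussian μ ρ) x = Complex.exp (-(Real.pi * (ρ : ℂ)) * (x : ℂ) ^ 2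
      + (2 * Real.pi * Complex.I * α + 2 * Real.pi * ρ * μ) * (x : ℂ)
      + -(Real.pi * ρ * μ ^ 2)) := by
  rw [Pi.mul_apply, osc, gaussian, ← Complex.exp_add]
  congr 1
  ring

theorem continuous_osc_mul_gaussian (α μ ρ : ℚ) : Continuous (osc α * gaussian μ ρ) := by
  have : osc α * gaussian μ ρ = fun x => (osc α * gaussian μ ρ) x := rfl
  rw [this]
  simp only [osc_mul_gaussian_apply]
  fun_prop

theorem integrable_osc_mul_gaussian {α μ ρ : ℚ} (hρ : 0 < ρ) :
    Integrable (osc α * gaussian μ ρ) := by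
  have : osc α * gaussian μ ρ = fun x => (osc α * gaussian μ ρ) x := rfl
  rw [this]
  simp only [osc_mul_gaussian_apply]
  apply integrable_cexp_quadratic'
  have : -(Real.pi * (ρ : ℂ)) = ((-(Real.pi * (ρ : ℝ)) : ℝ) : ℂ) := by push_cast; ring
  rw [this, Complex.ofReal_re]
  have : 0 < (ρ : ℝ) := by exact_mod_cast hρ
  have := Real.pi_pos
  have : 0 < Real.pi * (ρ : ℝ) := by positivity
  linarith

theorem norm_osc_mul_gaussian_le {α μ ρ : ℚ} (hρ : 0 < ρ) (x : ℝ) :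
    ‖(osc α * gaussian μ ρ) x‖ ≤ 1 := by
  have h1 : osc α x = Complex.exp (((2 * Real.pi * α * x : ℝ) : ℂ) * Complex.I) := by
    rw [osc]
    congr 1
    push_cast
    ring
  have h2 : gaussian μ ρ x = Complex.exp (((-(Real.pi * ρ * (x - μ) ^ 2) : ℝ)) : ℂ) := by
    rw [gaussian]
    congr 1
    push_cast
    ring
  rw [Pi.mul_apply, norm_mul, h1, Complex.norm_exp_ofReal_mul_I, one_mul, h2, Complex.norm_exp,
    Complex.ofReal_re, Real.exp_le_one_iff]
  have : 0 < (ρ : ℝ) := by exact_mod_cast hρ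
  have := Real.pi_pos
  have : 0 ≤ Real.pi * (ρ : ℝ) * (x - μ) ^ 2 := by positivity
  linarith

theorem gaussianClosure_regular {f : ℝ → ℂ} (hf : f ∈ gaussianClosure) :
    Continuous f ∧ Integrable f ∧ ∃ C : ℝ, ∀ x, ‖f x‖ ≤ C := by
  induction hf using Submodule.span_induction with
  | mem f hf =>
    obtain ⟨α, μ, ρ, hρ, rfl⟩ := hf
    exact ⟨continuous_osc_mul_gaussian α μ ρ, integrable_osc_mul_gaussian hρ, 1,
      norm_osc_mul_gaussian_le hρ⟩
  | zero => exact ⟨continuous_const, integrable_zero _ _ _, 0, fun x => by simp⟩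
  | add f g _ _ hf hg =>
    obtain ⟨hf1, hf2, C, hC⟩ := hf
    obtain ⟨hg1, hg2, D, hD⟩ := hg
    exact ⟨hf1.add hg1, hf2.add hg2, C + D,
      fun x => (norm_add_le _ _).trans (add_le_add (hC x) (hD x))⟩
  | smul k f _ hf =>
    obtain ⟨hf1, hf2, C, hC⟩ := hf
    refine ⟨continuous_const.mul hf1, hf2.const_mul (k : ℂ), ‖(k : ℂ)‖ * C, fun x => ?_⟩
    change ‖(k : ℂ) * f x‖ ≤ _
    rw [norm_mul]
    exact mul_le_mul_of_nonneg_left (hC x) (norm_nonneg _)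

theorem convolutionExists_of_mem {f g : ℝ → ℂ} (hf : f ∈ gaussianClosure)
    (hg : g ∈ gaussianClosure) :
    ConvolutionExists f g (ContinuousLinearMap.mul ℂ ℂ) volume := by
  intro x
  obtain ⟨-, hf2, -⟩ := gaussianClosure_regular hf
  obtain ⟨hg1, -, D, hD⟩ := gaussianClosure_regular hg
  exact hf2.mul_bdd (c := D)
    (hg1.comp (continuous_const.sub continuous_id)).aestronglyMeasurable
    (Filter.Eventually.of_forall fun t => hD (x - t))

theorem realConv_add_left {f f' g : ℝ → ℂ} (hf : f ∈ gaussianClosure) (hf' : f' ∈ gaussianClosure)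
    (hg : g ∈ gaussianClosure) : realConv (f + f') g = realConv f g + realConv f' g :=
  (convolutionExists_of_mem hf hg).add_distrib (convolutionExists_of_mem hf' hg)

theorem realConv_smul_left (k : gelfondField) (f g : ℝ → ℂ) :
    realConv (k • f) g = k • realConv f g :=
  smul_convolution (y := (k : ℂ))

theorem realConv_comm (f g : ℝ → ℂ) : realConv f g = realConv g f := by
  funext x
  rw [realConv_apply, realConv, convolution_mul_swap]
  exact integral_congr_ae (Filter.Eventually.of_forall fun t => mul_comm _ _)

theorem realConv_assoc {f g k : ℝ → ℂ} (hf : f ∈ gaussianClosure) (hg : g ∈ gaussianClosure)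
    (hk : k ∈ gaussianClosure) : realConv (realConv f g) k = realConv f (realConv g k) := by
  obtain ⟨hf1, hf2, C, hC⟩ := gaussianClosure_regular hf
  obtain ⟨hg1, hg2, D, hD⟩ := gaussianClosure_regular hg
  obtain ⟨hk1, hk2, E, hE⟩ := gaussianClosure_regular hk
  have hgk : ∀ x, ConvolutionExistsAt (fun x => ‖g x‖) (fun x => ‖k x‖) x
      (ContinuousLinearMap.mul ℝ ℝ) volume := fun x =>
    hg2.norm.mul_bdd (c := E)
      (hk1.norm.comp (continuous_const.sub continuous_id)).aestronglyMeasurable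
      (Filter.Eventually.of_forall fun t => by simpa using hE (x - t))
  funext x
  refine convolution_assoc _ _ _ _ (fun a b c => by simp [mul_assoc])
    hf1.aestronglyMeasurable hg1.aestronglyMeasurable hk1.aestronglyMeasurable
    (Filter.Eventually.of_forall (convolutionExists_of_mem hf hg))
    (Filter.Eventually.of_forall hgk) ?_
  have hcont : Continuous (convolution (fun x => ‖g x‖) (fun x => ‖k x‖)
      (ContinuousLinearMap.mul ℝ ℝ) volume) :=
    BddAbove.continuous_convolution_right_of_integrable _
      ⟨E, by rintro _ ⟨y, rfl⟩; simpa using hE y⟩ hg2.norm hk1.norm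
  refine hf2.norm.mul_bdd (c := ∫ t, ‖g t‖ * E)
    (hcont.comp (continuous_const.sub continuous_id)).aestronglyMeasurable
    (Filter.Eventually.of_forall fun t => ?_)
  rw [convolution_mul]
  refine norm_integral_le_of_norm_le (hg2.norm.mul_const E) (Filter.Eventually.of_forall fun s => ?_)
  rw [norm_mul, norm_norm, norm_norm]
  exact mul_le_mul_of_nonneg_left (hE _) (norm_nonneg _)

/-- The convolution law of the functions `e_α g_{μ,ρ}`. -/
theorem realConv_osc_mul_gaussian {α α' μ μ' ρ ρ' : ℚ} (hρ : 0 < ρ) (hρ' : 0 < ρ') :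
    realConv (osc α * gaussian μ ρ) (osc α' * gaussian μ' ρ')
      = ((((Real.sqrt ((ρ + ρ' : ℚ) : ℝ) : ℝ) : ℂ))⁻¹ * Complex.exp (Real.pi *
          (((-(α - α') ^ 2 / (ρ + ρ') : ℚ) : ℂ)
            + ((2 * (α - α') * (μ * ρ - μ' * ρ') / (ρ + ρ') : ℚ) : ℂ) * Complex.I)))
        • (osc ((α * ρ' + α' * ρ) / (ρ + ρ')) * gaussian (μ + μ') (ρ * ρ' / (ρ + ρ'))) := by
  have hσ : 0 < ρ + ρ' := add_pos hρ hρ'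
  have hσ' : (0 : ℝ) < ((ρ + ρ' : ℚ) : ℝ) := by exact_mod_cast hσ
  have hσC : ((ρ : ℂ) + (ρ' : ℂ)) ≠ 0 := by exact_mod_cast hσ.ne'
  have hπ : (Real.pi : ℂ) ≠ 0 := by exact_mod_cast Real.pi_ne_zero
  funext x
  rw [realConv_apply, Pi.smul_apply, osc_mul_gaussian_apply, smul_eq_mul, mul_assoc,
    ← Complex.exp_add]
  have h1 : ∀ t : ℝ, (osc α * gaussian μ ρ) t * (osc α' * gaussian μ' ρ') (x - t)
      = Complex.exp (-(Real.pi * ((ρ : ℂ) + ρ')) * (t : ℂ) ^ 2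
        + (2 * Real.pi * Complex.I * (α - α') + 2 * Real.pi * ρ * μ
            + 2 * Real.pi * ρ' * (x - μ')) * (t : ℂ)
        + (2 * Real.pi * Complex.I * α' * x - Real.pi * ρ * μ ^ 2
            - Real.pi * ρ' * (x - μ') ^ 2)) := by
    intro t
    rw [osc_mul_gaussian_apply, osc_mul_gaussian_apply, ← Complex.exp_add]
    congr 1
    push_cast
    ring
  simp only [h1]
  rw [integral_cexp_quadratic]
  · congr 1
    · have h2 : (Real.pi : ℂ) / -(-(Real.pi * ((ρ : ℂ) + ρ')))
          = (((((ρ + ρ' : ℚ) : ℝ))⁻¹ : ℝ) : ℂ) := by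
        push_cast
        field_simp
      have h3 : (1 / 2 : ℂ) = ((1 / 2 : ℝ) : ℂ) := by push_cast; ring
      rw [h2, h3, ← Complex.ofReal_cpow (inv_nonneg.2 hσ'.le), ← Real.sqrt_eq_rpow, Real.sqrt_inv,
        Complex.ofReal_inv]
    · congr 1
      push_cast
      field_simp
      ring_nf
      simp only [Complex.I_sq]
      ring
  · have h4 : -((Real.pi : ℂ) * ((ρ : ℂ) + ρ')) = ((-(Real.pi * ((ρ + ρ' : ℚ) : ℝ)) : ℝ) : ℂ) := by
      push_cast
      ring
    rw [h4, Complex.ofReal_re]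
    have := mul_pos Real.pi_pos hσ'
    linarith

/-- The pointwise product law of the functions `e_α g_{μ,ρ}`. -/
theorem mul_osc_mul_gaussian {α α' μ μ' ρ ρ' : ℚ} (hρ : 0 < ρ) (hρ' : 0 < ρ') :
    (osc α * gaussian μ ρ) * (osc α' * gaussian μ' ρ')
      = Complex.exp (Real.pi * (((-(ρ * ρ' / (ρ + ρ')) * (μ - μ') ^ 2 : ℚ) : ℂ)
          + ((0 : ℚ) : ℂ) * Complex.I))
        • (osc (α + α') * gaussian ((μ * ρ + μ' * ρ') / (ρ + ρ')) (ρ + ρ')) := by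
  have hσC : ((ρ : ℂ) + (ρ' : ℂ)) ≠ 0 := by exact_mod_cast (add_pos hρ hρ').ne'
  funext x
  rw [Pi.mul_apply, Pi.smul_apply, smul_eq_mul]
  simp only [osc_mul_gaussian_apply]
  rw [← Complex.exp_add, ← Complex.exp_add]
  congr 1
  push_cast
  field_simp
  ring

/-- The Heisenberg action on the functions `e_α g_{μ,ρ}`. -/
theorem heisenbergAction_osc_mul_gaussian (h : HeisenbergGroup ratDuality) (α μ ρ : ℚ) :
    heisenbergAction h (osc α * gaussian μ ρ)
      = (((h.torus : Circle) : ℂ) * (((ratChar (-(α + h.mom) * h.pos) : RationalTorus) : Circle) : ℂ))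
        • (osc (α + h.mom) * gaussian (μ + h.pos) ρ) := by
  funext y
  rw [heisenbergAction_apply, Pi.smul_apply, smul_eq_mul, mul_assoc, coe_ratChar]
  simp only [osc_mul_gaussian_apply]
  rw [osc, ← Complex.exp_add, ← Complex.exp_add]
  congr 2
  push_cast
  ring

theorem realConv_mem {f g : ℝ → ℂ} (hf : f ∈ gaussianClosure) (hg : g ∈ gaussianClosure) :
    realConv f g ∈ gaussianClosure := by
  have key : ∀ {f : ℝ → ℂ}, f ∈ gaussianClosure → ∀ α μ ρ : ℚ, 0 < ρ →
      realConv f (osc α * gaussian μ ρ) ∈ gaussianClosure := by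
    intro f hf α μ ρ hρ
    induction hf using Submodule.span_induction with
    | mem f hf =>
      obtain ⟨α', μ', ρ', hρ', rfl⟩ := hf
      rw [realConv_osc_mul_gaussian hρ' hρ]
      exact smul_osc_mul_gaussian_mem
        (mul_mem (inv_mem (sqrt_mem_gelfondField _)) (exp_mem_gelfondField _ _))
        (div_pos (mul_pos hρ' hρ) (add_pos hρ' hρ))
    | zero =>
      have h := realConv_smul_left 0 0 (osc α * gaussian μ ρ)
      rw [zero_smul, zero_smul] at h
      rw [h]
      exact zero_mem _
    | add f f' hf hf' h h' =>
      rw [realConv_add_left hf hf' (osc_mul_gaussian_mem hρ)]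
      exact add_mem h h'
    | smul k f _ h =>
      rw [realConv_smul_left]
      exact gaussianClosure.smul_mem k h
  rw [realConv_comm]
  induction hg using Submodule.span_induction with
  | mem g hg =>
    obtain ⟨α, μ, ρ, hρ, rfl⟩ := hg
    rw [realConv_comm]
    exact key hf α μ ρ hρ
  | zero =>
    have h := realConv_smul_left 0 0 f
    rw [zero_smul, zero_smul] at h
    rw [h]
    exact zero_mem _
  | add g g' hg hg' h h' =>
    rw [realConv_add_left hg hg' hf]
    exact add_mem h h'
  | smul k g _ h =>
    rw [realConv_smul_left]
    exact gaussianClosure.smul_mem k h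

theorem mul_mem_gaussianClosure {f g : ℝ → ℂ} (hf : f ∈ gaussianClosure)
    (hg : g ∈ gaussianClosure) : f * g ∈ gaussianClosure := by
  induction hf using Submodule.span_induction with
  | mem f hf =>
    obtain ⟨α, μ, ρ, hρ, rfl⟩ := hf
    induction hg using Submodule.span_induction with
    | mem g hg =>
      obtain ⟨α', μ', ρ', hρ', rfl⟩ := hg
      rw [mul_osc_mul_gaussian hρ hρ']
      exact smul_osc_mul_gaussian_mem (exp_mem_gelfondField _ _) (add_pos hρ hρ')
    | zero =>
      rw [mul_zero]
      exact zero_mem _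
    | add g g' _ _ h h' =>
      rw [mul_add]
      exact add_mem h h'
    | smul k g _ h =>
      rw [mul_smul_comm]
      exact gaussianClosure.smul_mem k h
  | zero =>
    rw [zero_mul]
    exact zero_mem _
  | add f f' _ _ h h' =>
    rw [add_mul]
    exact add_mem h h'
  | smul k f _ h =>
    rw [smul_mul_assoc]
    exact gaussianClosure.smul_mem k h

theorem heisenbergAction_mem (h : HeisenbergGroup ratDuality) {f : ℝ → ℂ}
    (hf : f ∈ gaussianClosure) : heisenbergAction h f ∈ gaussianClosure := by
  induction hf using Submodule.span_induction with
  | mem f hf =>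
    obtain ⟨α, μ, ρ, hρ, rfl⟩ := hf
    rw [heisenbergAction_osc_mul_gaussian]
    exact smul_osc_mul_gaussian_mem
      (mul_mem (ratTorusAction h.torus).2 (ratTorusAction (ratChar _)).2) hρ
  | zero =>
    rw [map_zero]
    exact zero_mem _
  | add f f' _ _ h h' =>
    rw [map_add]
    exact add_mem h h'
  | smul k f _ h =>
    rw [map_smul]
    exact gaussianClosure.smul_mem k h

/-- The rational Gaussian singlet as a Heisenberg twain algebra over `ℚ^π`: convolution and
pointwise product of functions, with the action of the rational Heisenberg group by translations and
modulations. -/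
def gaussianAlgebra : HeisenbergTwainAlgebra ratDuality ratTorusAction gaussianClosure where
  conv := LinearMap.mk₂ gelfondField
    (fun f g => ⟨realConv f g, realConv_mem f.2 g.2⟩)
    (fun f f' g => Subtype.ext (realConv_add_left f.2 f'.2 g.2))
    (fun k f g => Subtype.ext (realConv_smul_left k f g))
    (fun f g g' => Subtype.ext (by
      change realConv (f : ℝ → ℂ) ((g : ℝ → ℂ) + g') = realConv (f : ℝ → ℂ) g + realConv (f : ℝ → ℂ) g'
      rw [realConv_comm, realConv_add_left g.2 g'.2 f.2, realConv_comm g, realConv_comm g']))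
    (fun k f g => Subtype.ext (by
      change realConv (f : ℝ → ℂ) (k • (g : ℝ → ℂ)) = k • realConv (f : ℝ → ℂ) g
      rw [realConv_comm, realConv_smul_left, realConv_comm]))
  ptw := LinearMap.mk₂ gelfondField
    (fun f g => ⟨(f : ℝ → ℂ) * g, mul_mem_gaussianClosure f.2 g.2⟩)
    (fun f f' g => Subtype.ext (add_mul (f : ℝ → ℂ) f' g))
    (fun k f g => Subtype.ext (smul_mul_assoc k (f : ℝ → ℂ) (g : ℝ → ℂ)))
    (fun f g g' => Subtype.ext (mul_add (f : ℝ → ℂ) g g'))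
    (fun k f g => Subtype.ext (mul_smul_comm k (f : ℝ → ℂ) (g : ℝ → ℂ)))
  conv_comm f g := Subtype.ext (realConv_comm f g)
  conv_assoc f g k := Subtype.ext (realConv_assoc f.2 g.2 k.2)
  ptw_comm f g := Subtype.ext (mul_comm (f : ℝ → ℂ) g)
  ptw_assoc f g k := Subtype.ext (mul_assoc (f : ℝ → ℂ) g k)
  act :=
    { toFun := fun h => (heisenbergAction h).restrict (fun _ hf => heisenbergAction_mem h hf)
      map_one' := by
        apply LinearMap.ext
        intro f
        apply Subtype.ext
        change heisenbergAction 1 (f : ℝ → ℂ) = f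
        rw [map_one]
        rfl
      map_mul' := fun h k => by
        apply LinearMap.ext
        intro f
        apply Subtype.ext
        change heisenbergAction (h * k) (f : ℝ → ℂ) = heisenbergAction h (heisenbergAction k f)
        rw [map_mul]
        rfl }
  act_torus c f := by
    apply Subtype.ext
    funext y
    change ((c : Circle) : ℂ) * (osc 0 (y - ((0 : ℚ) : ℝ)) * (f : ℝ → ℂ) (y - ((0 : ℚ) : ℝ)))
      = ((c : Circle) : ℂ) * (f : ℝ → ℂ) y
    simp [osc]
  conv_scalar c x f g := by
    apply Subtype.ext
    funext y
    change ((c : Circle) : ℂ) * (osc 0 (y - (x : ℝ)) * realConv (f : ℝ → ℂ) g (y - (x : ℝ)))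
      = realConv (heisenbergAction ⟨c, x, 0⟩ (f : ℝ → ℂ)) g y
    rw [realConv_apply, realConv_apply, ← mul_assoc, ← integral_const_mul,
      ← integral_sub_right_eq_self _ (x : ℝ)]
    refine integral_congr_ae (Filter.Eventually.of_forall fun t => ?_)
    have h1 : y - (x : ℝ) - (t - (x : ℝ)) = y - t := by ring
    simp only [heisenbergAction_apply, h1, osc]
    push_cast
    simp only [mul_zero, zero_mul, Complex.exp_zero]
    ring
  conv_operator ξ f g := by
    apply Subtype.ext
    funext y
    change (((1 : RationalTorus) : Circle) : ℂ) * (osc ξ (y - ((0 : ℚ) : ℝ))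
        * realConv (f : ℝ → ℂ) g (y - ((0 : ℚ) : ℝ)))
      = realConv (heisenbergAction (ofMom ξ) (f : ℝ → ℂ))
          (heisenbergAction (ofMom ξ) (g : ℝ → ℂ)) y
    rw [realConv_apply, realConv_apply, ← mul_assoc, ← integral_const_mul]
    refine integral_congr_ae (Filter.Eventually.of_forall fun t => ?_)
    have h1 : osc ξ y = osc ξ t * osc ξ (y - t) := by
      rw [osc, osc, osc, ← Complex.exp_add]
      congr 1
      push_cast
      ring
    simp only [heisenbergAction_apply, HeisenbergGroup.ofMom, Rat.cast_zero, sub_zero, h1,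
      OneMemClass.coe_one, Circle.coe_one]
    ring
  ptw_scalar c ξ f g := by
    apply Subtype.ext
    funext y
    change ((c : Circle) : ℂ) * (osc ξ (y - ((0 : ℚ) : ℝ))
        * ((f : ℝ → ℂ) (y - ((0 : ℚ) : ℝ)) * (g : ℝ → ℂ) (y - ((0 : ℚ) : ℝ))))
      = (((c : Circle) : ℂ) * (osc ξ (y - ((0 : ℚ) : ℝ)) * (f : ℝ → ℂ) (y - ((0 : ℚ) : ℝ))))
        * (g : ℝ → ℂ) y
    rw [Rat.cast_zero, sub_zero]
    ring
  ptw_operator x f g := by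
    apply Subtype.ext
    funext y
    change (((1 : RationalTorus) : Circle) : ℂ) * (osc 0 (y - (x : ℝ))
        * ((f : ℝ → ℂ) (y - (x : ℝ)) * (g : ℝ → ℂ) (y - (x : ℝ))))
      = ((((1 : RationalTorus) : Circle) : ℂ) * (osc 0 (y - (x : ℝ)) * (f : ℝ → ℂ) (y - (x : ℝ))))
        * ((((1 : RationalTorus) : Circle) : ℂ) * (osc 0 (y - (x : ℝ)) * (g : ℝ → ℂ) (y - (x : ℝ))))
    simp only [osc, Rat.cast_zero, mul_zero, zero_mul, Complex.exp_zero, OneMemClass.coe_one,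
      Circle.coe_one, one_mul]

/-- The unit Gaussian `g = g_{0,1}`. -/
def unitGaussian : gaussianClosure :=
  ⟨gaussian 0 1, by
    have h : gaussian 0 1 = osc 0 * gaussian 0 1 := by
      funext x
      simp [osc]
    rw [h]
    exact osc_mul_gaussian_mem one_pos⟩

/-! ### The relations -/

section Relations

variable {A : Type*} [AddCommGroup A] [Module gelfondField A]

/-- The `n`-th power (`n ≥ 1`) of `a` with respect to a product `m`. -/
def mulPow (m : A →ₗ[gelfondField] A →ₗ[gelfondField] A) (a : A) (n : ℕ) : A :=
  (fun s => m s a)^[n - 1] a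

variable (𝒜 : HeisenbergTwainAlgebra ratDuality ratTorusAction A) (u : A)

/-- `u_ρ = √(m n^{m-1}) (u^n)^{⋆m}` for a rational number `ρ = n / m > 0` in lowest terms. -/
def scaledGen (ρ : ℚ) : A :=
  gelfondSqrt (ρ.den * (ρ.num : ℚ) ^ (ρ.den - 1)) •
    mulPow 𝒜.conv (mulPow 𝒜.ptw u ρ.num.toNat) ρ.den

/-- The convolution laws. -/
def convRelations : Set A :=
  {r | ∃ α α' ρ ρ' : ℚ, 0 < ρ ∧ 0 < ρ' ∧
    r = 𝒜.conv (𝒜.act (ofMom α) (scaledGen 𝒜 u ρ)) (𝒜.act (ofMom α') (scaledGen 𝒜 u ρ'))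
      - (gelfondExp (-(α - α') ^ 2 / (ρ + ρ')) / gelfondSqrt (ρ + ρ')) •
        𝒜.act (ofMom ((α * ρ' + α' * ρ) / (ρ + ρ'))) (scaledGen 𝒜 u (ρ * ρ' / (ρ + ρ')))}

/-- The pointwise product laws. -/
def ptwRelations : Set A :=
  {r | ∃ μ μ' ρ ρ' : ℚ, 0 < ρ ∧ 0 < ρ' ∧
    r = 𝒜.ptw (𝒜.act (ofPos μ) (scaledGen 𝒜 u ρ)) (𝒜.act (ofPos μ') (scaledGen 𝒜 u ρ'))
      - gelfondExp (-(ρ * ρ' / (ρ + ρ')) * (μ - μ') ^ 2) •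
        𝒜.act (ofPos ((μ * ρ + μ' * ρ') / (ρ + ρ'))) (scaledGen 𝒜 u (ρ + ρ'))}

/-- The laws commuting convolution powers with pointwise powers. -/
def convPtwRelations : Set A :=
  {r | ∃ n m : ℕ, 0 < n ∧ 0 < m ∧
    r = mulPow 𝒜.ptw (mulPow 𝒜.conv u m) n
      - gelfondSqrt ((n : ℚ) ^ (m - 1) / (m : ℚ) ^ (n - 1)) •
        mulPow 𝒜.conv (mulPow 𝒜.ptw u n) m}

/-- The relation set `ℛ_u`. -/
def gaussianRelations : Set A :=
  convRelations 𝒜 u ∪ ptwRelations 𝒜 u ∪ convPtwRelations 𝒜 u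

end Relations

/-- The free Heisenberg twain algebra `𝔗(u)` on one generator over the rational Heisenberg group
and the Gelfond field. -/
abbrev freeOne : HeisenbergTwainAlgebra ratDuality ratTorusAction
    (FreeTwain ratDuality ratTorusAction Unit) :=
  FreeTwain.algebra ratDuality ratTorusAction Unit

/-- The generator `u` of `𝔗(u)`. -/
abbrev freeGen : FreeTwain ratDuality ratTorusAction Unit :=
  FreeTwain.gen ratDuality ratTorusAction ()

/-- The twain Heisenberg ideal `⟨ℛ_u⟩` of `𝔗(u)`. -/
abbrev relationIdeal : Submodule gelfondField (FreeTwain ratDuality ratTorusAction Unit) :=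
  freeOne.idealSpan (gaussianRelations freeOne freeGen)

/-- The quotient Heisenberg twain algebra `𝔗(u) / ⟨ℛ_u⟩`. -/
abbrev presentedAlgebra : HeisenbergTwainAlgebra ratDuality ratTorusAction
    (FreeTwain ratDuality ratTorusAction Unit ⧸ relationIdeal) :=
  freeOne.quotient relationIdeal (freeOne.isIdeal_idealSpan _)

end Gaussians

end HeisTwain

/-! The presented algebra and $\mathcal G$ are compared through one family of elements, $\alpha(\mu
u_\rho)$ with $\alpha,\mu,\rho\in\mathbb{Q}$ and $\rho>0$. It spans the first algebra, and its image
in the second is a basis.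

Existence of a map: for $u=g$ the element $u_\rho$ is the centered Gaussian $g_{0,\rho}$, because
the factor $\sqrt{m\,n^{m-1}}$ cancels the constant produced by the $m$-fold convolution of
$g_{0,n}$ (`coe_scaledGen`). The relations then reduce to explicit Gaussian integrals and products
(`gaussianRelations_unitGaussian`), so the universal properties of the free algebra and of the
quotient give `presentedToGaussian`.

Spanning: an element of $H$ is, up to a torus scalar, a momentum times a position. In a convolution
the positions are scalars and can be pulled out, and the convolution law evaluates what is left; in
a pointwise product momenta and positions exchange roles. Hence the span of the family is closed
under all operations, and it contains $u=u_1$ (`span_gaussianFamily_presentedAlgebra`).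

Independence: the family maps to the functions $e_\alpha g_{\mu,\rho}$. In a vanishing combination,
divide by the Gaussian that decays most slowly at $+\infty$. A finite sum of rational exponentials
$e_\alpha$ remains, and it tends to $0$. Being periodic, it vanishes identically, and Dedekind's
independence of characters kills its coefficients (`linearIndependent_osc_mul_gaussian`).

A linear map that carries a spanning family to a linearly independent one is injective, and this one
reaches all generators of $\mathcal G$. Uniqueness holds because $u$ generates. -/

namespace HeisTwain

open HeisenbergGroup Filter Topology

/-! ### Homomorphisms, quotients and the universal property of the free algebra -/

section Hom

variable {Γ G T : Type*} [AddCommGroup Γ] [AddCommGroup G] [CommGroup T]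
  {K : Type*} [CommRing K] {β : Duality Γ G T} {ε : T →* K}
  {A B : Type*} [AddCommGroup A] [Module K A] [AddCommGroup B] [Module K B]

/-- A homomorphism of Heisenberg twain algebras: an equivariant linear map that respects both
products. -/
structure HeisenbergTwainHom (𝒜 : HeisenbergTwainAlgebra β ε A)
    (ℬ : HeisenbergTwainAlgebra β ε B) extends A →ₗ[K] B where
  map_conv : ∀ a b, toFun (𝒜.conv a b) = ℬ.conv (toFun a) (toFun b)
  map_ptw : ∀ a b, toFun (𝒜.ptw a b) = ℬ.ptw (toFun a) (toFun b)
  map_act : ∀ h a, toFun (𝒜.act h a) = ℬ.act h (toFun a)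

/-- The kernel of a homomorphism is a twain Heisenberg ideal. -/
theorem HeisenbergTwainHom.isIdeal_ker {𝒜 : HeisenbergTwainAlgebra β ε A}
    {ℬ : HeisenbergTwainAlgebra β ε B} (f : HeisenbergTwainHom 𝒜 ℬ) :
    𝒜.IsIdeal (LinearMap.ker f.toLinearMap) where
  conv_mem a b hb := by
    rw [LinearMap.mem_ker] at hb ⊢
    rw [show f.toLinearMap (𝒜.conv a b) = ℬ.conv (f.toLinearMap a) (f.toLinearMap b) from
      f.map_conv a b, hb, map_zero]
  ptw_mem a b hb := by
    rw [LinearMap.mem_ker] at hb ⊢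
    rw [show f.toLinearMap (𝒜.ptw a b) = ℬ.ptw (f.toLinearMap a) (f.toLinearMap b) from
      f.map_ptw a b, hb, map_zero]
  act_mem h b hb := by
    rw [LinearMap.mem_ker] at hb ⊢
    rw [show f.toLinearMap (𝒜.act h b) = ℬ.act h (f.toLinearMap b) from
      f.map_act h b, hb, map_zero]

/-- The projection onto the quotient by a twain Heisenberg ideal. -/
def HeisenbergTwainAlgebra.quotientHom (𝒜 : HeisenbergTwainAlgebra β ε A) (I : Submodule K A)
    (hI : 𝒜.IsIdeal I) : HeisenbergTwainHom 𝒜 (𝒜.quotient I hI) where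
  toLinearMap := I.mkQ
  map_conv _ _ := rfl
  map_ptw _ _ := rfl
  map_act _ _ := rfl

/-- A homomorphism vanishing on `R` descends to the quotient by the ideal generated by `R`. -/
def HeisenbergTwainHom.liftQ {𝒜 : HeisenbergTwainAlgebra β ε A}
    {ℬ : HeisenbergTwainAlgebra β ε B} (f : HeisenbergTwainHom 𝒜 ℬ) (R : Set A)
    (hR : R ⊆ LinearMap.ker f.toLinearMap) :
    HeisenbergTwainHom (𝒜.quotient (𝒜.idealSpan R) (𝒜.isIdeal_idealSpan R)) ℬ where
  -- The kernel is itself one of the ideals containing `R`, so the intersection defining `idealSpan`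
  -- lies below it.
  toLinearMap := (𝒜.idealSpan R).liftQ f.toLinearMap (sInf_le ⟨f.isIdeal_ker, hR⟩)
  map_conv := by
    rintro ⟨a⟩ ⟨b⟩
    exact f.map_conv a b
  map_ptw := by
    rintro ⟨a⟩ ⟨b⟩
    exact f.map_ptw a b
  map_act := by
    rintro h ⟨a⟩
    exact f.map_act h a

theorem HeisenbergTwainAlgebra.subset_idealSpan (𝒜 : HeisenbergTwainAlgebra β ε A) (R : Set A) :
    R ⊆ 𝒜.idealSpan R := fun r hr => by
  rw [SetLike.mem_coe, idealSpan, Submodule.mem_sInf]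
  exact fun I hI => hI.2 hr

/-- Interpretation of terms in a Heisenberg twain algebra. -/
def HeisenbergTwainAlgebra.interpret {X : Type*} (𝒜 : HeisenbergTwainAlgebra β ε A) (a : X → A) :
    Term β K X → A
  | .gen x => a x
  | .zero => 0
  | .add s t => 𝒜.interpret a s + 𝒜.interpret a t
  | .smul k s => k • 𝒜.interpret a s
  | .act h s => 𝒜.act h (𝒜.interpret a s)
  | .conv s t => 𝒜.conv (𝒜.interpret a s) (𝒜.interpret a t)
  | .ptw s t => 𝒜.ptw (𝒜.interpret a s) (𝒜.interpret a t)

/-- Each constructor of `TermRel` is either a congruence, preserved by any interpretation, or an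
axiom that holds in every Heisenberg twain algebra. This makes `interpret` descend to the free
algebra. -/
theorem HeisenbergTwainAlgebra.interpret_eq_of_rel {X : Type*}
    (𝒜 : HeisenbergTwainAlgebra β ε A) (a : X → A) {s t : Term β K X} (h : TermRel β ε X s t) :
    𝒜.interpret a s = 𝒜.interpret a t := by
  induction h with
  | add_congr_left _ _ ih | add_congr_right _ _ ih | smul_congr _ _ ih | act_congr _ _ ih
  | conv_congr_left _ _ ih | conv_congr_right _ _ ih | ptw_congr_left _ _ ih
  | ptw_congr_right _ _ ih => simp only [interpret, ih]
  | add_assoc => exact _root_.add_assoc _ _ _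
  | add_comm => exact _root_.add_comm _ _
  | zero_add => exact _root_.zero_add _
  | one_smul => exact _root_.one_smul _ _
  | mul_smul => exact SemigroupAction.mul_smul _ _ _
  | smul_add => exact _root_.smul_add _ _ _
  | add_smul => exact _root_.add_smul _ _ _
  | zero_smul => exact _root_.zero_smul _ _
  | act_one => simp [interpret]
  | act_mul => simp [interpret]
  | act_add => simp [interpret]
  | act_smul => simp [interpret]
  | act_torus => exact 𝒜.act_torus _ _
  | conv_add => simp [interpret]
  | conv_smul => simp [interpret]
  | conv_comm => exact 𝒜.conv_comm _ _
  | conv_assoc => exact 𝒜.conv_assoc _ _ _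
  | ptw_add => simp [interpret]
  | ptw_smul => simp [interpret]
  | ptw_comm => exact 𝒜.ptw_comm _ _
  | ptw_assoc => exact 𝒜.ptw_assoc _ _ _
  | conv_scalar => exact 𝒜.conv_scalar _ _ _ _
  | conv_operator => exact 𝒜.conv_operator _ _ _
  | ptw_scalar => exact 𝒜.ptw_scalar _ _ _ _
  | ptw_operator => exact 𝒜.ptw_operator _ _ _

/-- The homomorphism out of the free Heisenberg twain algebra with prescribed values on the
generators. -/
def FreeTwain.lift {X : Type*} (𝒜 : HeisenbergTwainAlgebra β ε A) (a : X → A) :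
    HeisenbergTwainHom (FreeTwain.algebra β ε X) 𝒜 where
  toFun := Quot.lift (𝒜.interpret a) fun _ _ h => 𝒜.interpret_eq_of_rel a h
  map_add' := by
    rintro ⟨s⟩ ⟨t⟩
    rfl
  map_smul' := by
    rintro k ⟨s⟩
    rfl
  map_conv := by
    rintro ⟨s⟩ ⟨t⟩
    rfl
  map_ptw := by
    rintro ⟨s⟩ ⟨t⟩
    rfl
  map_act := by
    rintro h ⟨s⟩
    rfl

/-- Induction on the elements of the free Heisenberg twain algebra. -/
theorem FreeTwain.induction {X : Type*} {p : FreeTwain β ε X → Prop}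
    (gen : ∀ x, p (FreeTwain.gen β ε x)) (zero : p 0) (add : ∀ s t, p s → p t → p (s + t))
    (smul : ∀ (k : K) s, p s → p (k • s))
    (act : ∀ h s, p s → p ((FreeTwain.algebra β ε X).act h s))
    (conv : ∀ s t, p s → p t → p ((FreeTwain.algebra β ε X).conv s t))
    (ptw : ∀ s t, p s → p t → p ((FreeTwain.algebra β ε X).ptw s t)) (s : FreeTwain β ε X) :
    p s := by
  obtain ⟨s⟩ := s
  induction s with
  | gen x => exact gen x
  | zero => exact zero
  | add s t hs ht => exact add _ _ hs ht
  | smul k s hs => exact smul k _ hs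
  | act h s hs => exact act h _ hs
  | conv s t hs ht => exact conv _ _ hs ht
  | ptw s t hs ht => exact ptw _ _ hs ht

/-- Homomorphisms out of the free Heisenberg twain algebra are determined by their values on the
generators. -/
theorem FreeTwain.hom_ext {X : Type*} {𝒜 : HeisenbergTwainAlgebra β ε A}
    (f g : HeisenbergTwainHom (FreeTwain.algebra β ε X) 𝒜)
    (h : ∀ x, f.toLinearMap (FreeTwain.gen β ε x) = g.toLinearMap (FreeTwain.gen β ε x))
    (s : FreeTwain β ε X) : f.toLinearMap s = g.toLinearMap s := by
  induction s using FreeTwain.induction with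
  | gen x => exact h x
  | zero => rw [map_zero, map_zero]
  | add s t hs ht => rw [map_add, map_add, hs, ht]
  | smul k s hs => rw [map_smul, map_smul, hs]
  | act k s hs =>
    exact (f.map_act k s).trans ((congrArg (𝒜.act k) hs).trans (g.map_act k s).symm)
  | conv s t hs ht =>
    exact (f.map_conv s t).trans
      ((congrArg₂ (fun a b => 𝒜.conv a b) hs ht).trans (g.map_conv s t).symm)
  | ptw s t hs ht =>
    exact (f.map_ptw s t).trans
      ((congrArg₂ (fun a b => 𝒜.ptw a b) hs ht).trans (g.map_ptw s t).symm)

/-- The composition of a homomorphism with an isomorphism. -/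
def HeisenbergTwainHom.compEquiv {C : Type*} [AddCommGroup C] [Module K C]
    {𝒜 : HeisenbergTwainAlgebra β ε A} {ℬ : HeisenbergTwainAlgebra β ε B}
    {𝒞 : HeisenbergTwainAlgebra β ε C} (f : HeisenbergTwainHom 𝒜 ℬ)
    (e : HeisenbergTwainEquiv ℬ 𝒞) : HeisenbergTwainHom 𝒜 𝒞 where
  toLinearMap := e.toLinearEquiv.toLinearMap ∘ₗ f.toLinearMap
  map_conv a b := (congrArg e.toLinearEquiv (f.map_conv a b)).trans (e.map_conv _ _)
  map_ptw a b := (congrArg e.toLinearEquiv (f.map_ptw a b)).trans (e.map_ptw _ _)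
  map_act h a := (congrArg e.toLinearEquiv (f.map_act h a)).trans (e.map_act _ _)

/-- The inverse of a bijective homomorphism. -/
noncomputable def HeisenbergTwainHom.symmOfBijective {𝒜 : HeisenbergTwainAlgebra β ε A}
    {ℬ : HeisenbergTwainAlgebra β ε B} (f : HeisenbergTwainHom 𝒜 ℬ)
    (hf : Function.Bijective f.toLinearMap) : HeisenbergTwainEquiv ℬ 𝒜 where
  toLinearEquiv := (LinearEquiv.ofBijective f.toLinearMap hf).symm
  map_conv a b := by
    refine (LinearEquiv.symm_apply_eq (LinearEquiv.ofBijective f.toLinearMap hf)).2 ?_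
    refine Eq.trans ?_ (f.map_conv _ _).symm
    exact congrArg₂ (fun a b => ℬ.conv a b)
      ((LinearEquiv.ofBijective f.toLinearMap hf).apply_symm_apply a).symm
      ((LinearEquiv.ofBijective f.toLinearMap hf).apply_symm_apply b).symm
  map_ptw a b := by
    refine (LinearEquiv.symm_apply_eq (LinearEquiv.ofBijective f.toLinearMap hf)).2 ?_
    refine Eq.trans ?_ (f.map_ptw _ _).symm
    exact congrArg₂ (fun a b => ℬ.ptw a b)
      ((LinearEquiv.ofBijective f.toLinearMap hf).apply_symm_apply a).symm
      ((LinearEquiv.ofBijective f.toLinearMap hf).apply_symm_apply b).symm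
  map_act h a := by
    refine (LinearEquiv.symm_apply_eq (LinearEquiv.ofBijective f.toLinearMap hf)).2 ?_
    refine Eq.trans ?_ (f.map_act _ _).symm
    exact congrArg (ℬ.act h)
      ((LinearEquiv.ofBijective f.toLinearMap hf).apply_symm_apply a).symm

end Hom

/-! ### Linear independence of the functions $e_\alpha g_{\mu,\rho}$ -/

theorem osc_eq_iff_forall {α α' : ℚ} (h : ∀ x, osc α x = osc α' x) : α = α' := by
  by_contra hne
  have hd : α - α' ≠ 0 := sub_ne_zero.2 hne
  -- At $x=1/(2(\alpha-\alpha'))$ the quotient $e_\alpha/e_{\alpha'}$ equals $e^{\pi i}=-1$.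
  have h1 := h ((1 / 2 / (α - α') : ℚ) : ℝ)
  have h2 : osc α ((1 / 2 / (α - α') : ℚ) : ℝ)
      = osc α' ((1 / 2 / (α - α') : ℚ) : ℝ) * Complex.exp (Real.pi * Complex.I) := by
    rw [osc, osc, ← Complex.exp_add]
    congr 1
    have hd' : (α : ℂ) - (α' : ℂ) ≠ 0 := by exact_mod_cast hd
    push_cast
    field_simp
    ring
  rw [h1, Complex.exp_pi_mul_I] at h2
  have h3 : osc α' ((1 / 2 / (α - α') : ℚ) : ℝ) ≠ 0 := Complex.exp_ne_zero _
  apply h3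
  linear_combination h2 / 2

/-- The oscillating exponentials as characters of the real line. -/
noncomputable def oscHom (α : ℚ) : Multiplicative ℝ →* ℂ where
  toFun x := osc α x.toAdd
  map_one' := by simp [osc]
  map_mul' x y := by
    simp only [osc, toAdd_mul]
    rw [← Complex.exp_add]
    congr 1
    push_cast
    ring

/-- Dedekind: distinct characters of a monoid with values in a field are linearly independent. -/
theorem linearIndependent_osc : LinearIndependent ℂ osc := by
  have h := (linearIndependent_monoidHom (Multiplicative ℝ) ℂ).comp oscHom fun α α' h =>
    osc_eq_iff_forall fun x => DFunLike.congr_fun h (Multiplicative.ofAdd x)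
  exact h

/-- This is where rationality of the frequencies enters: finitely many of them share an integer
period, such as the product of their denominators. -/
theorem osc_periodic {α : ℚ} {N : ℕ} (h : α.den ∣ N) : Function.Periodic (osc α) N := by
  obtain ⟨d, rfl⟩ := h
  intro x
  rw [osc, osc, Complex.exp_eq_exp_iff_exists_int]
  refine ⟨α.num * d, ?_⟩
  have h1 : (α : ℂ) * (α.den : ℂ) = (α.num : ℂ) := by exact_mod_cast Rat.mul_den_eq_num α
  push_cast
  rw [← h1]
  ring

/-- A finite sum of rational oscillating exponentials that tends to zero at infinity vanishes. -/
theorem sum_osc_eq_zero_of_tendsto {s : Finset ℚ} {c : ℚ → ℂ}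
    (h : Tendsto (fun x => ∑ α ∈ s, c α * osc α x) atTop (𝓝 0)) {α : ℚ} (hα : α ∈ s) :
    c α = 0 := by
  set F : ℝ → ℂ := fun x => ∑ α ∈ s, c α * osc α x with hF
  set N : ℕ := ∏ α ∈ s, α.den with hN
  have hN0 : (0 : ℝ) < N := by
    exact_mod_cast Finset.prod_pos fun (α : ℚ) _ => α.pos
  have hper : Function.Periodic F N := fun x => Finset.sum_congr rfl fun α hα => by
    rw [osc_periodic (Finset.dvd_prod_of_mem _ hα) x]
  have hz : ∀ x, F x = 0 := fun x => by
    -- Sampled along $x+kN$ the sum is constant in $k$, so its limit $0$ is its value at $x$.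
    have h1 : Tendsto (fun k : ℕ => x + k * (N : ℝ)) atTop atTop :=
      tendsto_atTop_add_const_left _ _ (tendsto_natCast_atTop_atTop.atTop_mul_const hN0)
    have h2 := h.comp h1
    have h3 : F ∘ (fun k : ℕ => x + k * (N : ℝ)) = fun _ => F x := by
      funext k
      exact hper.nat_mul k x
    rw [h3] at h2
    exact tendsto_nhds_unique tendsto_const_nhds h2
  refine linearIndependent_iff'.1 linearIndependent_osc s c ?_ α hα
  funext x
  simpa [hF] using hz x

/-- Among the functions `e_α g_{μ,ρ}`, smaller `ρ`, and then larger `μ`, dominates at infinity. -/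
theorem tendsto_gaussian_div {α μ μ₀ ρ ρ₀ : ℚ} (hρ₀ : 0 < ρ₀)
    (h : ρ₀ < ρ ∨ ρ = ρ₀ ∧ μ < μ₀) :
    Tendsto (fun x => (osc α * gaussian μ ρ) x / gaussian μ₀ ρ₀ x) atTop (𝓝 0) := by
  rw [tendsto_zero_iff_norm_tendsto_zero]
  have h1 : ∀ x : ℝ, ‖(osc α * gaussian μ ρ) x / gaussian μ₀ ρ₀ x‖
      = Real.exp (-(x * ((Real.pi * (ρ - ρ₀)) * x + 2 * Real.pi * (ρ₀ * μ₀ - ρ * μ))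
        + Real.pi * (ρ * μ ^ 2 - ρ₀ * μ₀ ^ 2))) := by
    intro x
    rw [osc_mul_gaussian_apply, gaussian, ← Complex.exp_sub, Complex.norm_exp]
    congr 1
    -- The exponent is split into real and imaginary parts; the norm sees only the real part, so the
    -- frequency $\alpha$ drops out.
    have : (-(Real.pi * (ρ : ℂ)) * (x : ℂ) ^ 2
      + (2 * Real.pi * Complex.I * α + 2 * Real.pi * ρ * μ) * (x : ℂ)
      + -(Real.pi * ρ * μ ^ 2) - -(Real.pi * (ρ₀ : ℂ) * ((x : ℂ) - (μ₀ : ℂ)) ^ 2))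
      = ((-(x * ((Real.pi * (ρ - ρ₀)) * x + 2 * Real.pi * (ρ₀ * μ₀ - ρ * μ))
        + Real.pi * (ρ * μ ^ 2 - ρ₀ * μ₀ ^ 2)) : ℝ) : ℂ)
        + ((2 * Real.pi * α * x : ℝ) : ℂ) * Complex.I := by
      push_cast
      ring
    rw [this, Complex.add_re, Complex.ofReal_re, Complex.re_ofReal_mul, Complex.I_re, mul_zero,
      add_zero]
  simp only [h1]
  refine Real.tendsto_exp_neg_atTop_nhds_zero.comp (tendsto_atTop_add_const_right _ _ ?_)
  -- The negated exponent must tend to $+\infty$: it is quadratic with leading coefficient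
  -- $\pi(\rho-\rho_0)>0$ in the first case, and linear with slope $2\pi\rho(\mu_0-\mu)>0$ in the
  -- second.
  rcases h with h | ⟨rfl, h⟩
  · have h2 : (0 : ℝ) < Real.pi * (ρ - ρ₀) :=
      mul_pos Real.pi_pos (sub_pos.2 (by exact_mod_cast h))
    exact tendsto_id.atTop_mul_atTop₀
      (tendsto_atTop_add_const_right _ _ (tendsto_id.const_mul_atTop h2))
  · have h2 : (0 : ℝ) < 2 * Real.pi * (ρ * μ₀ - ρ * μ) := by
      have h3 : (0 : ℝ) < (ρ : ℝ) := by exact_mod_cast hρ₀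
      have h4 : (0 : ℝ) < (μ₀ : ℝ) - μ := sub_pos.2 (by exact_mod_cast h)
      have := mul_pos (mul_pos two_pos Real.pi_pos) (mul_pos h3 h4)
      rwa [mul_sub (ρ : ℝ)] at this
    simp only [sub_self, mul_zero, zero_mul, zero_add]
    exact tendsto_id.atTop_mul_const h2

/-- The parameters `(α, μ, ρ)` with `ρ > 0`. -/
abbrev GaussianIndex : Type := {p : ℚ × ℚ × ℚ // 0 < p.2.2}

/-- The functions `e_α g_{μ,ρ}` are linearly independent. -/
theorem linearIndependent_osc_mul_gaussian :
    LinearIndependent ℂ fun p : GaussianIndex => osc p.1.1 * gaussian p.1.2.1 p.1.2.2 := by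
  classical
  rw [linearIndependent_iff']
  intro s c hs
  by_contra! hne
  obtain ⟨i, hi, hci⟩ := hne
  set t := s.filter fun p => c p ≠ 0 with ht
  -- The dominant term at $+\infty$ has the least $\rho$ and, among those, the greatest $\mu$, hence
  -- the sign in the lexicographic key. The frequency is left out of the key, so the ties are
  -- exactly the indices in the range of `q` below.
  obtain ⟨p₀, hp₀, hmin⟩ := t.exists_min_image
    (fun p => toLex (p.1.2.2, -p.1.2.1)) ⟨i, by simp [ht, hi, hci]⟩
  obtain ⟨⟨α₀, μ₀, ρ₀⟩, hρ₀⟩ := p₀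
  have hρ₀' : 0 < ρ₀ := hρ₀
  set q : ℚ → GaussianIndex := fun α => ⟨(α, μ₀, ρ₀), hρ₀⟩ with hq
  have hqi : Function.Injective q := fun a b h => congrArg (fun p => p.1.1) h
  have hsum : ∀ x, ∑ p ∈ t, c p * ((osc p.1.1 * gaussian p.1.2.1 p.1.2.2) x
      / gaussian μ₀ ρ₀ x) = 0 := by
    intro x
    have h1 := congrFun hs x
    simp only [Finset.sum_apply, Pi.smul_apply, smul_eq_mul, Pi.zero_apply] at h1
    have h2 : ∑ p ∈ t, c p * (osc p.1.1 * gaussian p.1.2.1 p.1.2.2) x = 0 := by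
      rw [← h1, ht]
      refine Finset.sum_filter_of_ne fun p _ hp hc => hp ?_
      rw [hc, zero_mul]
    simp only [← mul_div_assoc]
    rw [← Finset.sum_div, h2, zero_div]
  have hlim : Tendsto (fun x => ∑ α ∈ (t.preimage q hqi.injOn), c (q α) * osc α x) atTop (𝓝 0) := by
    -- The terms with $(\mu,\rho)\ne(\mu_0,\rho_0)$ are negligible after division by
    -- $g_{\mu_0,\rho_0}$.
    have h1 : Tendsto (fun x => ∑ p ∈ t.filter (· ∉ Set.range q),
        c p * ((osc p.1.1 * gaussian p.1.2.1 p.1.2.2) x / gaussian μ₀ ρ₀ x)) atTop (𝓝 0) := by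
      refine (tendsto_finsetSum (a := fun _ => (0 : ℂ)) _ fun p hp => ?_).trans
        (by rw [Finset.sum_const_zero])
      refine ((tendsto_gaussian_div hρ₀' ?_).const_mul (c p)).trans (by rw [mul_zero])
      obtain ⟨hpt, hpq⟩ := Finset.mem_filter.1 hp
      have h2 := hmin p hpt
      obtain ⟨⟨α, μ, ρ⟩, hρ⟩ := p
      rw [Prod.Lex.le_iff] at h2
      simp only [ofLex_toLex, neg_le_neg_iff] at h2
      rcases h2 with h2 | ⟨h2, h3⟩
      · exact Or.inl h2
      · refine Or.inr ⟨h2.symm, lt_of_le_of_ne h3 ?_⟩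
        rintro rfl
        subst h2
        exact hpq ⟨α, rfl⟩
    -- For the tied terms the division cancels the Gaussian and leaves $e_\alpha$. The whole sum
    -- being zero, this part is minus the negligible part.
    have h2 : (fun x => ∑ α ∈ (t.preimage q hqi.injOn), c (q α) * osc α x)
        = fun x => -∑ p ∈ t.filter (· ∉ Set.range q),
        c p * ((osc p.1.1 * gaussian p.1.2.1 p.1.2.2) x / gaussian μ₀ ρ₀ x) := by
      funext x
      rw [eq_neg_iff_add_eq_zero, ← hsum x, ← Finset.sum_filter_add_sum_filter_not t (· ∈ Set.range q)]
      congr 1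
      rw [← Finset.sum_preimage' q t hqi.injOn]
      refine Finset.sum_congr rfl fun α _ => ?_
      have h3 : gaussian μ₀ ρ₀ x ≠ 0 := Complex.exp_ne_zero _
      simp only [hq, Pi.mul_apply]
      rw [mul_div_cancel_right₀ _ h3]
    rw [h2]
    simpa only [neg_zero] using h1.neg
  have h0 := sum_osc_eq_zero_of_tendsto (c := fun α => c (q α)) hlim (α := α₀)
    (by simpa [hq] using hp₀)
  exact (Finset.mem_filter.1 hp₀).2 h0

/-! ### The span of the elements $\alpha(\mu u_\rho)$ is closed under all operations -/

section Span

variable {A : Type*} [AddCommGroup A] [Module gelfondField A]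
  (𝒜 : HeisenbergTwainAlgebra ratDuality ratTorusAction A) (u : A)

theorem act_mul_apply (h k : HeisenbergGroup ratDuality) (a : A) :
    𝒜.act (h * k) a = 𝒜.act h (𝒜.act k a) := by
  rw [map_mul, Module.End.mul_apply]

/-- The factorization suited to $\star$, with the $\star$-scalar part outermost. In this order the
group law pairs only zeros, so no phase appears. -/
theorem act_eq_pos_act_mom (h : HeisenbergGroup ratDuality) (a : A) :
    𝒜.act h a = 𝒜.act ⟨h.torus, h.pos, 0⟩ (𝒜.act (ofMom h.mom) a) := by
  rw [← act_mul_apply]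
  congr 2
  rw [mul_def]
  ext1 <;> simp [ofMom, Duality.pair_zero_right]

/-- The factorization suited to the pointwise product. Here the group law produces
$\langle\xi,x\rangle$, which the torus component has to compensate. -/
theorem act_eq_mom_act_pos (h : HeisenbergGroup ratDuality) (a : A) :
    𝒜.act h a = 𝒜.act ⟨h.torus * (ratDuality.pair h.mom h.pos)⁻¹, 0, h.mom⟩
      (𝒜.act (ofPos h.pos) a) := by
  rw [← act_mul_apply]
  congr 2
  rw [mul_def]
  ext1 <;> simp [ofPos]

theorem act_eq_smul (h : HeisenbergGroup ratDuality) (a : A) :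
    𝒜.act h a = ratTorusAction (h.torus * (ratDuality.pair h.mom h.pos)⁻¹) •
      𝒜.act (ofMom h.mom) (𝒜.act (ofPos h.pos) a) := by
  rw [← 𝒜.act_torus, ← act_mul_apply, ← act_mul_apply]
  congr 2
  simp only [mul_def, ofTorus, ofMom, ofPos]
  ext1 <;> simp [Duality.pair_zero_right]

/-- Elements of $\mathbb{T}_{\mathbb{Q}}G$ are scalars for $\star$, and by commutativity they leave
either factor. Only momenta stay inside, which is the shape of the left side of the convolution law.
-/
theorem conv_act_act (h k : HeisenbergGroup ratDuality) (a b : A) :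
    𝒜.conv (𝒜.act h a) (𝒜.act k b) = 𝒜.act (⟨h.torus, h.pos, 0⟩ * ⟨k.torus, k.pos, 0⟩)
      (𝒜.conv (𝒜.act (ofMom h.mom) a) (𝒜.act (ofMom k.mom) b)) := by
  rw [act_eq_pos_act_mom 𝒜 h, act_eq_pos_act_mom 𝒜 k, ← 𝒜.conv_scalar, 𝒜.conv_comm,
    ← 𝒜.conv_scalar, act_mul_apply, 𝒜.conv_comm (𝒜.act (ofMom k.mom) b)]

/-- The counterpart of `conv_act_act`: momenta leave the product, and positions stay inside as in
the pointwise product law. -/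
theorem ptw_act_act (h k : HeisenbergGroup ratDuality) (a b : A) :
    𝒜.ptw (𝒜.act h a) (𝒜.act k b) =
      𝒜.act (⟨h.torus * (ratDuality.pair h.mom h.pos)⁻¹, 0, h.mom⟩
          * ⟨k.torus * (ratDuality.pair k.mom k.pos)⁻¹, 0, k.mom⟩)
        (𝒜.ptw (𝒜.act (ofPos h.pos) a) (𝒜.act (ofPos k.pos) b)) := by
  rw [act_eq_mom_act_pos 𝒜 h, act_eq_mom_act_pos 𝒜 k, ← 𝒜.ptw_scalar, 𝒜.ptw_comm,
    ← 𝒜.ptw_scalar, act_mul_apply, 𝒜.ptw_comm (𝒜.act (ofPos k.pos) b)]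

/-- The translated and modulated generators `α (μ u_ρ)`. -/
noncomputable def gaussianFamily (p : GaussianIndex) : A :=
  𝒜.act (ofMom p.1.1) (𝒜.act (ofPos p.1.2.1) (scaledGen 𝒜 u p.1.2.2))

variable {u}

theorem act_scaledGen_mem_span (h : HeisenbergGroup ratDuality) {ρ : ℚ} (hρ : 0 < ρ) :
    𝒜.act h (scaledGen 𝒜 u ρ)
      ∈ Submodule.span gelfondField (Set.range (gaussianFamily 𝒜 u)) := by
  rw [act_eq_smul]
  exact Submodule.smul_mem _ _ (Submodule.subset_span ⟨⟨(h.mom, h.pos, ρ), hρ⟩, rfl⟩)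

theorem act_mem_span (h : HeisenbergGroup ratDuality) {a : A}
    (ha : a ∈ Submodule.span gelfondField (Set.range (gaussianFamily 𝒜 u))) :
    𝒜.act h a ∈ Submodule.span gelfondField (Set.range (gaussianFamily 𝒜 u)) := by
  refine (Submodule.span_le
    (p := (Submodule.span gelfondField (Set.range (gaussianFamily 𝒜 u))).comap (𝒜.act h))).2 ?_ ha
  rintro _ ⟨p, rfl⟩
  rw [SetLike.mem_coe, Submodule.mem_comap, gaussianFamily, ← act_mul_apply,
    ← act_mul_apply]
  exact act_scaledGen_mem_span 𝒜 _ p.2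

/-- A bilinear map that sends pairs of generators of a submodule into the submodule preserves it. -/
theorem map₂_mem_span {R M : Type*} [CommRing R] [AddCommGroup M] [Module R M]
    (m : M →ₗ[R] M →ₗ[R] M) {s : Set M}
    (hs : ∀ a ∈ s, ∀ b ∈ s, m a b ∈ Submodule.span R s) {a b : M}
    (ha : a ∈ Submodule.span R s) (hb : b ∈ Submodule.span R s) : m a b ∈ Submodule.span R s := by
  have h : Submodule.map₂ m (Submodule.span R s) (Submodule.span R s) ≤ Submodule.span R s := by
    rw [Submodule.map₂_span_span, Submodule.span_le]
    rintro _ ⟨a, ha, b, hb, rfl⟩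
    exact hs a ha b hb
  exact h (Submodule.apply_mem_map₂ m ha hb)

theorem conv_mem_span (hR : ∀ r ∈ convRelations 𝒜 u, r = 0) {a b : A}
    (ha : a ∈ Submodule.span gelfondField (Set.range (gaussianFamily 𝒜 u)))
    (hb : b ∈ Submodule.span gelfondField (Set.range (gaussianFamily 𝒜 u))) :
    𝒜.conv a b ∈ Submodule.span gelfondField (Set.range (gaussianFamily 𝒜 u)) := by
  refine map₂_mem_span 𝒜.conv ?_ ha hb
  rintro _ ⟨p, rfl⟩ _ ⟨q, rfl⟩
  simp only [gaussianFamily, ← act_mul_apply]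
  -- The convolution law collapses the inner product to a multiple of a single translate of
  -- $u_{\rho\boxplus\rho'}$ under $H$, on which the outer group element acts again.
  rw [conv_act_act, sub_eq_zero.1 (hR _ ⟨_, _, _, _, p.2, q.2, rfl⟩), map_smul,
    ← act_mul_apply]
  exact Submodule.smul_mem _ _ (act_scaledGen_mem_span 𝒜 _
    (div_pos (mul_pos p.2 q.2) (add_pos p.2 q.2)))

theorem ptw_mem_span (hR : ∀ r ∈ ptwRelations 𝒜 u, r = 0) {a b : A}
    (ha : a ∈ Submodule.span gelfondField (Set.range (gaussianFamily 𝒜 u)))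
    (hb : b ∈ Submodule.span gelfondField (Set.range (gaussianFamily 𝒜 u))) :
    𝒜.ptw a b ∈ Submodule.span gelfondField (Set.range (gaussianFamily 𝒜 u)) := by
  refine map₂_mem_span 𝒜.ptw ?_ ha hb
  rintro _ ⟨p, rfl⟩ _ ⟨q, rfl⟩
  simp only [gaussianFamily, ← act_mul_apply]
  rw [ptw_act_act, sub_eq_zero.1 (hR _ ⟨_, _, _, _, p.2, q.2, rfl⟩), map_smul,
    ← act_mul_apply]
  exact Submodule.smul_mem _ _ (act_scaledGen_mem_span 𝒜 _ (add_pos p.2 q.2))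

theorem gelfondSqrt_one : gelfondSqrt 1 = 1 := Subtype.ext (by simp [gelfondSqrt])

theorem scaledGen_one : scaledGen 𝒜 u 1 = u := by
  simp [scaledGen, mulPow, gelfondSqrt_one]

theorem gen_mem_span : u ∈ Submodule.span gelfondField (Set.range (gaussianFamily 𝒜 u)) := by
  have h := act_scaledGen_mem_span 𝒜 (u := u) 1 one_pos
  rwa [map_one, scaledGen_one] at h

end Span

/-! ### Homomorphisms transport powers, $u_\rho$ and the relations -/

section Map

variable {A B : Type*} [AddCommGroup A] [Module gelfondField A] [AddCommGroup B]
  [Module gelfondField B] {𝒜 : HeisenbergTwainAlgebra ratDuality ratTorusAction A}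
  {ℬ : HeisenbergTwainAlgebra ratDuality ratTorusAction B}

theorem map_mulPow (f : A →ₗ[gelfondField] B) {m : A →ₗ[gelfondField] A →ₗ[gelfondField] A}
    {m' : B →ₗ[gelfondField] B →ₗ[gelfondField] B} (hm : ∀ a b, f (m a b) = m' (f a) (f b))
    (a : A) (n : ℕ) : f (mulPow m a n) = mulPow m' (f a) n :=
  (show Function.Semiconj f (fun s => m s a) (fun s => m' s (f a)) from
    fun s => hm s a).iterate_right _ a

namespace HeisenbergTwainHom

variable (f : HeisenbergTwainHom 𝒜 ℬ)

theorem apply_conv (a b : A) :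
    f.toLinearMap (𝒜.conv a b) = ℬ.conv (f.toLinearMap a) (f.toLinearMap b) := f.map_conv a b

theorem apply_ptw (a b : A) :
    f.toLinearMap (𝒜.ptw a b) = ℬ.ptw (f.toLinearMap a) (f.toLinearMap b) := f.map_ptw a b

theorem apply_act (h : HeisenbergGroup ratDuality) (a : A) :
    f.toLinearMap (𝒜.act h a) = ℬ.act h (f.toLinearMap a) := f.map_act h a

theorem map_scaledGen (u : A) (ρ : ℚ) :
    f.toLinearMap (scaledGen 𝒜 u ρ) = scaledGen ℬ (f.toLinearMap u) ρ := by
  rw [scaledGen, scaledGen, map_smul, map_mulPow _ f.apply_conv, map_mulPow _ f.apply_ptw]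

theorem map_gaussianFamily (u : A) (p : GaussianIndex) :
    f.toLinearMap (gaussianFamily 𝒜 u p) = gaussianFamily ℬ (f.toLinearMap u) p := by
  rw [gaussianFamily, gaussianFamily, apply_act, apply_act, map_scaledGen]

/-- Homomorphisms map the relations of an element onto the relations of its image. -/
theorem image_gaussianRelations (u : A) :
    f.toLinearMap '' gaussianRelations 𝒜 u = gaussianRelations ℬ (f.toLinearMap u) := by
  have hc : f.toLinearMap '' convRelations 𝒜 u = convRelations ℬ (f.toLinearMap u) := by
    ext r
    constructor
    · rintro ⟨_, ⟨α, α', ρ, ρ', hρ, hρ', rfl⟩, rfl⟩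
      refine ⟨α, α', ρ, ρ', hρ, hρ', ?_⟩
      simp only [map_sub, map_smul, apply_conv, apply_act, map_scaledGen]
    · rintro ⟨α, α', ρ, ρ', hρ, hρ', rfl⟩
      refine ⟨_, ⟨α, α', ρ, ρ', hρ, hρ', rfl⟩, ?_⟩
      simp only [map_sub, map_smul, apply_conv, apply_act, map_scaledGen]
  have hp : f.toLinearMap '' ptwRelations 𝒜 u = ptwRelations ℬ (f.toLinearMap u) := by
    ext r
    constructor
    · rintro ⟨_, ⟨μ, μ', ρ, ρ', hρ, hρ', rfl⟩, rfl⟩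
      refine ⟨μ, μ', ρ, ρ', hρ, hρ', ?_⟩
      simp only [map_sub, map_smul, apply_ptw, apply_act, map_scaledGen]
    · rintro ⟨μ, μ', ρ, ρ', hρ, hρ', rfl⟩
      refine ⟨_, ⟨μ, μ', ρ, ρ', hρ, hρ', rfl⟩, ?_⟩
      simp only [map_sub, map_smul, apply_ptw, apply_act, map_scaledGen]
  have hcp : f.toLinearMap '' convPtwRelations 𝒜 u = convPtwRelations ℬ (f.toLinearMap u) := by
    ext r
    constructor
    · rintro ⟨_, ⟨n, m, hn, hm, rfl⟩, rfl⟩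
      refine ⟨n, m, hn, hm, ?_⟩
      simp only [map_sub, map_smul, map_mulPow _ f.apply_conv, map_mulPow _ f.apply_ptw]
    · rintro ⟨n, m, hn, hm, rfl⟩
      refine ⟨_, ⟨n, m, hn, hm, rfl⟩, ?_⟩
      simp only [map_sub, map_smul, map_mulPow _ f.apply_conv, map_mulPow _ f.apply_ptw]
  rw [gaussianRelations, gaussianRelations, Set.image_union, Set.image_union, hc, hp, hcp]

end HeisenbergTwainHom

end Map

/-! ### Powers of centered Gaussians and the value of $u_\rho$ at the unit Gaussian -/

theorem gelfondSqrt_mul {p : ℚ} (hp : 0 ≤ p) (q : ℚ) :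
    gelfondSqrt (p * q) = gelfondSqrt p * gelfondSqrt q := by
  apply Subtype.ext
  change ((Real.sqrt ((p * q : ℚ) : ℝ) : ℝ) : ℂ)
    = ((Real.sqrt (p : ℝ) : ℝ) : ℂ) * ((Real.sqrt (q : ℝ) : ℝ) : ℂ)
  -- No sign condition on `q` is needed: `Real.sqrt` is zero on negative numbers, so for $q<0$ both
  -- sides vanish.
  rw [Rat.cast_mul, Real.sqrt_mul (by exact_mod_cast hp), Complex.ofReal_mul]

theorem gelfondSqrt_pow {p : ℚ} (hp : 0 ≤ p) (n : ℕ) : gelfondSqrt (p ^ n) = gelfondSqrt p ^ n := by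
  induction n with
  | zero => rw [pow_zero, pow_zero, gelfondSqrt_one]
  | succ n ih => rw [pow_succ, pow_succ, gelfondSqrt_mul (pow_nonneg hp n), ih]

theorem gelfondSqrt_ne_zero {p : ℚ} (hp : 0 < p) : gelfondSqrt p ≠ 0 := by
  intro h
  have h1 : ((Real.sqrt (p : ℝ) : ℝ) : ℂ) = 0 := congrArg Subtype.val h
  have h2 : (0 : ℝ) < p := by exact_mod_cast hp
  exact (Real.sqrt_pos.2 h2).ne' (by exact_mod_cast h1)

theorem osc_zero_mul (f : ℝ → ℂ) : osc 0 * f = f := by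
  funext x
  simp [osc]

theorem realConv_gaussian {ρ ρ' : ℚ} (hρ : 0 < ρ) (hρ' : 0 < ρ') :
    realConv (gaussian 0 ρ) (gaussian 0 ρ')
      = (gelfondSqrt (ρ + ρ'))⁻¹ • gaussian 0 (ρ * ρ' / (ρ + ρ')) := by
  have h := realConv_osc_mul_gaussian (α := 0) (α' := 0) (μ := 0) (μ' := 0) hρ hρ'
  have h1 : ((gelfondSqrt (ρ + ρ'))⁻¹ : gelfondField) • gaussian 0 (ρ * ρ' / (ρ + ρ'))
      = (((Real.sqrt ((ρ + ρ' : ℚ) : ℝ) : ℝ) : ℂ))⁻¹ • gaussian 0 (ρ * ρ' / (ρ + ρ')) := rfl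
  rw [h1]
  simpa [osc_zero_mul] using h

theorem gaussian_mul_gaussian {ρ ρ' : ℚ} (hρ : 0 < ρ) (hρ' : 0 < ρ') :
    gaussian 0 ρ * gaussian 0 ρ' = gaussian 0 (ρ + ρ') := by
  have h := mul_osc_mul_gaussian (α := 0) (α' := 0) (μ := 0) (μ' := 0) hρ hρ'
  simpa [osc_zero_mul] using h

section Pow

variable {A : Type*} [AddCommGroup A] [Module gelfondField A]

theorem mulPow_one (m : A →ₗ[gelfondField] A →ₗ[gelfondField] A) (a : A) : mulPow m a 1 = a := rfl

/-- The truncated exponent `n - 1` in `mulPow` makes the zeroth power equal to `a`, so the recursion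
starts only at $n=1$. -/
theorem mulPow_succ (m : A →ₗ[gelfondField] A →ₗ[gelfondField] A) (a : A) {n : ℕ} (hn : 1 ≤ n) :
    mulPow m a (n + 1) = m (mulPow m a n) a := by
  obtain ⟨n, rfl⟩ := Nat.exists_eq_add_of_le' hn
  exact Function.iterate_succ_apply' _ _ _

theorem mulPow_smul (m : A →ₗ[gelfondField] A →ₗ[gelfondField] A) (k : gelfondField) (a : A) {n : ℕ}
    (hn : 1 ≤ n) : mulPow m (k • a) n = k ^ n • mulPow m a n := by
  induction n, hn using Nat.le_induction with
  | base => rw [mulPow_one, mulPow_one, pow_one]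
  | succ n hn ih =>
    rw [mulPow_succ _ _ hn, mulPow_succ _ _ hn, ih, map_smul, map_smul, LinearMap.smul_apply,
      smul_smul, pow_succ']

end Pow

/-- Pointwise powers of centered Gaussians. -/
theorem coe_mulPow_ptw {a : gaussianClosure} {ρ : ℚ} (hρ : 0 < ρ)
    (ha : (a : ℝ → ℂ) = gaussian 0 ρ) {n : ℕ} (hn : 1 ≤ n) :
    ((mulPow gaussianAlgebra.ptw a n : gaussianClosure) : ℝ → ℂ) = gaussian 0 (n * ρ) := by
  induction n, hn using Nat.le_induction with
  | base => rw [mulPow_one, ha, Nat.cast_one, one_mul]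
  | succ n hn ih =>
    have hn' : (0 : ℚ) < n := by exact_mod_cast hn
    rw [mulPow_succ _ _ hn]
    change ((mulPow gaussianAlgebra.ptw a n : gaussianClosure) : ℝ → ℂ) * (a : ℝ → ℂ) = _
    rw [ih, ha, gaussian_mul_gaussian (mul_pos hn' hρ) hρ]
    congr 1
    push_cast
    ring

/-- Convolution powers of centered Gaussians. -/
theorem coe_mulPow_conv {a : gaussianClosure} {ρ : ℚ} (hρ : 0 < ρ)
    (ha : (a : ℝ → ℂ) = gaussian 0 ρ) {n : ℕ} (hn : 1 ≤ n) :
    ((mulPow gaussianAlgebra.conv a n : gaussianClosure) : ℝ → ℂ)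
      = (gelfondSqrt (n * ρ ^ (n - 1)))⁻¹ • gaussian 0 (ρ / n) := by
  induction n, hn using Nat.le_induction with
  | base => simp [mulPow_one, ha, gelfondSqrt_one]
  | succ n hn ih =>
    have hn' : (0 : ℚ) < n := by exact_mod_cast hn
    rw [mulPow_succ _ _ hn]
    change realConv ((mulPow gaussianAlgebra.conv a n : gaussianClosure) : ℝ → ℂ) (a : ℝ → ℂ) = _
    rw [ih, ha, realConv_smul_left, realConv_gaussian (div_pos hρ hn') hρ, smul_smul, ← mul_inv,
      ← gelfondSqrt_mul (by positivity)]
    obtain ⟨n, rfl⟩ := Nat.exists_eq_add_of_le' hn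
    -- The new constant is $n\rho^{n-1}(\rho/n+\rho)=(n+1)\rho^n$, and the new parameter is
    -- $(\rho/n)\boxplus\rho=\rho/(n+1)$.
    refine congrArg₂ (fun p σ => (gelfondSqrt p)⁻¹ • gaussian 0 σ) ?_ ?_
    · simp only [Nat.add_sub_cancel]
      push_cast
      field_simp
      ring
    · push_cast
      field_simp
      ring

/-- In the rational Gaussian singlet, `u_ρ` is the centered Gaussian `g_{0,ρ}`. -/
theorem coe_scaledGen {ρ : ℚ} (hρ : 0 < ρ) :
    ((scaledGen gaussianAlgebra unitGaussian ρ : gaussianClosure) : ℝ → ℂ) = gaussian 0 ρ := by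
  have hnum : 1 ≤ ρ.num.toNat := by
    have := Rat.num_pos.2 hρ
    lia
  have hcast : ((ρ.num.toNat : ℕ) : ℚ) = ρ.num := by
    exact_mod_cast Int.toNat_of_nonneg (Rat.num_pos.2 hρ).le
  have hpos : (0 : ℚ) < ρ.num := by exact_mod_cast Rat.num_pos.2 hρ
  have hden : (0 : ℚ) < ρ.den := by exact_mod_cast ρ.pos
  have h1 : ((mulPow gaussianAlgebra.ptw unitGaussian ρ.num.toNat : gaussianClosure) : ℝ → ℂ) = gaussian 0 ρ.num := by
    rw [coe_mulPow_ptw one_pos rfl hnum, hcast, mul_one]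
  -- With $\rho=n/m$, the $m$-th convolution power of $g_{0,n}$ is $(m\,n^{m-1})^{-1/2}g_{0,n/m}$;
  -- the normalization of $u_\rho$ is the inverse of this factor.
  rw [scaledGen, Submodule.coe_smul, coe_mulPow_conv hpos h1 ρ.pos, smul_smul,
    mul_inv_cancel₀ (gelfondSqrt_ne_zero (mul_pos hden (pow_pos hpos _))), one_smul, Rat.num_div_den]

/-! ### The unit Gaussian satisfies the relations -/

theorem coe_act (h : HeisenbergGroup ratDuality) (a : gaussianClosure) :
    ((gaussianAlgebra.act h a : gaussianClosure) : ℝ → ℂ) = heisenbergAction h a := rfl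

theorem ratChar_zero : ratChar 0 = 1 := by
  have h := ratChar_add 0 0
  rw [add_zero] at h
  exact left_eq_mul.1 h

theorem heisenbergAction_ofMom (α β μ ρ : ℚ) :
    heisenbergAction (ofMom α) (osc β * gaussian μ ρ) = osc (β + α) * gaussian μ ρ := by
  rw [heisenbergAction_osc_mul_gaussian]
  simp [ofMom, ratChar_zero]

theorem heisenbergAction_ofPos (μ ρ : ℚ) :
    heisenbergAction (ofPos μ) (gaussian 0 ρ) = gaussian μ ρ := by
  have h := heisenbergAction_osc_mul_gaussian (ofPos μ) 0 0 ρ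
  simpa [ofPos, ratChar_zero, osc_zero_mul] using h

/-- Translating first and modulating afterwards yields $e_\alpha g_{\mu,\rho}$ with no phase factor,
which is why `gaussianFamily` acts in this order. -/
theorem coe_gaussianFamily (p : GaussianIndex) :
    ((gaussianFamily gaussianAlgebra unitGaussian p : gaussianClosure) : ℝ → ℂ)
      = osc p.1.1 * gaussian p.1.2.1 p.1.2.2 := by
  rw [gaussianFamily, coe_act, coe_act, coe_scaledGen p.2, heisenbergAction_ofPos,
    ← osc_zero_mul (gaussian _ _), heisenbergAction_ofMom, zero_add, osc_zero_mul]

theorem coe_act_ofMom_scaledGen (α : ℚ) {ρ : ℚ} (hρ : 0 < ρ) :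
    ((gaussianAlgebra.act (ofMom α) (scaledGen gaussianAlgebra unitGaussian ρ) : gaussianClosure) : ℝ → ℂ)
      = osc α * gaussian 0 ρ := by
  rw [coe_act, coe_scaledGen hρ, ← osc_zero_mul (gaussian _ _), heisenbergAction_ofMom, zero_add,
    osc_zero_mul]

theorem coe_act_ofPos_scaledGen (μ : ℚ) {ρ : ℚ} (hρ : 0 < ρ) :
    ((gaussianAlgebra.act (ofPos μ) (scaledGen gaussianAlgebra unitGaussian ρ) : gaussianClosure) : ℝ → ℂ)
      = gaussian μ ρ := by
  rw [coe_act, coe_scaledGen hρ, heisenbergAction_ofPos]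

theorem convRelations_unitGaussian :
    ∀ r ∈ convRelations gaussianAlgebra unitGaussian, r = 0 := by
  rintro _ ⟨α, α', ρ, ρ', hρ, hρ', rfl⟩
  rw [sub_eq_zero]
  apply Subtype.ext
  rw [Submodule.coe_smul,
    coe_act_ofMom_scaledGen _ (div_pos (mul_pos hρ hρ') (add_pos hρ hρ'))]
  change realConv ((gaussianAlgebra.act (ofMom α) (scaledGen gaussianAlgebra unitGaussian ρ) : gaussianClosure) : ℝ → ℂ)
    ((gaussianAlgebra.act (ofMom α') (scaledGen gaussianAlgebra unitGaussian ρ') : gaussianClosure) : ℝ → ℂ) = _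
  rw [coe_act_ofMom_scaledGen _ hρ, coe_act_ofMom_scaledGen _ hρ', realConv_osc_mul_gaussian hρ hρ',
    add_zero]
  congr 1
  change _ = Complex.exp (Real.pi * ((-(α - α') ^ 2 / (ρ + ρ') : ℚ) : ℂ))
    / ((Real.sqrt ((ρ + ρ' : ℚ) : ℝ) : ℝ) : ℂ)
  rw [div_eq_inv_mul _ ((Real.sqrt ((ρ + ρ' : ℚ) : ℝ) : ℝ) : ℂ)]
  -- Both Gaussians are centered, so the imaginary part
  -- $2(\alpha-\alpha')(\mu\rho-\mu'\rho')/(\rho+\rho')$ of the general convolution law is zero.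
  congr 3
  simp

theorem ptwRelations_unitGaussian :
    ∀ r ∈ ptwRelations gaussianAlgebra unitGaussian, r = 0 := by
  rintro _ ⟨μ, μ', ρ, ρ', hρ, hρ', rfl⟩
  rw [sub_eq_zero]
  apply Subtype.ext
  rw [Submodule.coe_smul, coe_act_ofPos_scaledGen _ (add_pos hρ hρ')]
  change ((gaussianAlgebra.act (ofPos μ) (scaledGen gaussianAlgebra unitGaussian ρ) : gaussianClosure) : ℝ → ℂ)
    * ((gaussianAlgebra.act (ofPos μ') (scaledGen gaussianAlgebra unitGaussian ρ') : gaussianClosure) : ℝ → ℂ) = _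
  rw [coe_act_ofPos_scaledGen _ hρ, coe_act_ofPos_scaledGen _ hρ']
  have h := mul_osc_mul_gaussian (α := 0) (α' := 0) (μ := μ) (μ' := μ') hρ hρ'
  rw [add_zero, osc_zero_mul, osc_zero_mul, osc_zero_mul] at h
  rw [h]
  congr 1
  change _ = Complex.exp (Real.pi * ((-(ρ * ρ' / (ρ + ρ')) * (μ - μ') ^ 2 : ℚ) : ℂ))
  rw [Rat.cast_zero, zero_mul, add_zero]

/-- Both sides are multiples of $g_{0,n/m}$. On the left, $g^{\star m}=m^{-1/2}g_{0,1/m}$ has $n$-th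
power $m^{-n/2}g_{0,n/m}$; on the right, $(g^n)^{\star m}=(m\,n^{m-1})^{-1/2}g_{0,n/m}$. The square
root in the law is the ratio of the two constants. -/
theorem convPtwRelations_unitGaussian :
    ∀ r ∈ convPtwRelations gaussianAlgebra unitGaussian, r = 0 := by
  rintro _ ⟨n, m, hn, hm, rfl⟩
  have hn' : (0 : ℚ) < n := by exact_mod_cast hn
  have hm' : (0 : ℚ) < m := by exact_mod_cast hm
  rw [sub_eq_zero]
  have h1 : mulPow gaussianAlgebra.conv unitGaussian m
      = (gelfondSqrt m)⁻¹ • scaledGen gaussianAlgebra unitGaussian (1 / m) := by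
    apply Subtype.ext
    rw [Submodule.coe_smul, coe_mulPow_conv one_pos rfl hm, coe_scaledGen (by positivity), one_pow,
      mul_one]
  rw [h1, mulPow_smul _ _ _ hn]
  apply Subtype.ext
  rw [Submodule.coe_smul, Submodule.coe_smul,
    coe_mulPow_ptw (by positivity) (coe_scaledGen (by positivity)) hn,
    coe_mulPow_conv (ρ := n) hn' (by rw [coe_mulPow_ptw one_pos rfl hn, mul_one]) hm, smul_smul,
    mul_one_div]
  congr 1
  -- Clearing denominators and merging square roots reduces the claim to $m\,n^{m-1}=m^n\cdot
  -- n^{m-1}/m^{n-1}$ under the root.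
  rw [← div_eq_mul_inv, eq_div_iff (gelfondSqrt_ne_zero (by positivity)), inv_pow,
    inv_mul_eq_iff_eq_mul₀ (pow_ne_zero _ (gelfondSqrt_ne_zero hm')), ← gelfondSqrt_pow hm'.le,
    ← gelfondSqrt_mul (by positivity)]
  obtain ⟨n, rfl⟩ := Nat.exists_eq_add_of_le' hn
  congr 1
  rw [Nat.add_sub_cancel, pow_succ (m : ℚ)]
  field_simp

theorem gaussianRelations_unitGaussian :
    ∀ r ∈ gaussianRelations gaussianAlgebra unitGaussian, r = 0 := by
  rintro r ((hr | hr) | hr)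
  exacts [convRelations_unitGaussian r hr, ptwRelations_unitGaussian r hr,
    convPtwRelations_unitGaussian r hr]

/-! ### The comparison map and its bijectivity -/

/-- The homomorphism `𝔗(u) → 𝒢` that sends `u` to the unit Gaussian. -/
noncomputable def freeToGaussian : HeisenbergTwainHom freeOne gaussianAlgebra :=
  FreeTwain.lift gaussianAlgebra fun _ => unitGaussian

/-- The homomorphism `𝔗(u) / ⟨ℛ_u⟩ → 𝒢` that sends the class of `u` to the unit Gaussian. -/
noncomputable def presentedToGaussian : HeisenbergTwainHom presentedAlgebra gaussianAlgebra :=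
  freeToGaussian.liftQ (gaussianRelations freeOne freeGen) fun r hr =>
    gaussianRelations_unitGaussian (freeToGaussian.toLinearMap r) <| by
      -- A homomorphism carries the relations of $u$ to those of its image $g$, and these vanish in
      -- $\mathcal G$.
      change _ ∈ gaussianRelations _ (freeToGaussian.toLinearMap freeGen)
      rw [← freeToGaussian.image_gaussianRelations]
      exact ⟨r, hr, rfl⟩

theorem presentedToGaussian_gen :
    presentedToGaussian.toLinearMap (relationIdeal.mkQ freeGen) = unitGaussian := rfl

/-- The class of `u` satisfies the relations. -/
theorem gaussianRelations_presentedAlgebra :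
    ∀ r ∈ gaussianRelations presentedAlgebra (relationIdeal.mkQ freeGen), r = 0 := by
  intro r hr
  have h : r ∈ gaussianRelations presentedAlgebra
      ((freeOne.quotientHom relationIdeal (freeOne.isIdeal_idealSpan _)).toLinearMap freeGen) := hr
  rw [← HeisenbergTwainHom.image_gaussianRelations] at h
  obtain ⟨r, hr', rfl⟩ := h
  exact (Submodule.Quotient.mk_eq_zero _).2 (freeOne.subset_idealSpan _ hr')

/-- Every class is built from $u$ by the operations; the span contains $u$ and is closed under each
of them, the two products being handled by the convolution and pointwise product laws. -/
theorem span_gaussianFamily_presentedAlgebra :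
    Submodule.span gelfondField
      (Set.range (gaussianFamily presentedAlgebra (relationIdeal.mkQ freeGen))) = ⊤ := by
  rw [eq_top_iff]
  rintro a -
  obtain ⟨s, rfl⟩ := relationIdeal.mkQ_surjective a
  induction s using FreeTwain.induction with
  | gen x => exact gen_mem_span presentedAlgebra
  | zero => rw [map_zero]; exact zero_mem _
  | add s t hs ht => rw [map_add]; exact add_mem hs ht
  | smul k s hs => rw [map_smul]; exact Submodule.smul_mem _ k hs
  | act h s hs => exact act_mem_span presentedAlgebra h hs
  | conv s t hs ht =>
    exact conv_mem_span presentedAlgebra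
      (fun r hr => gaussianRelations_presentedAlgebra r (Or.inl (Or.inl hr))) hs ht
  | ptw s t hs ht =>
    exact ptw_mem_span presentedAlgebra
      (fun r hr => gaussianRelations_presentedAlgebra r (Or.inl (Or.inr hr))) hs ht

/-- Independence over $\mathbb{C}$ of the underlying functions implies independence over the
subfield $\mathbb{Q}^\pi$. -/
theorem linearIndependent_gaussianFamily :
    LinearIndependent gelfondField (gaussianFamily gaussianAlgebra unitGaussian) := by
  refine LinearIndependent.of_comp gaussianClosure.subtype ?_
  have h : gaussianClosure.subtype ∘ gaussianFamily gaussianAlgebra unitGaussian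
      = fun p : GaussianIndex => osc p.1.1 * gaussian p.1.2.1 p.1.2.2 :=
    funext coe_gaussianFamily
  rw [h]
  exact linearIndependent_osc_mul_gaussian.restrict_scalars' gelfondField

theorem presentedToGaussian_gaussianFamily (p : GaussianIndex) :
    presentedToGaussian.toLinearMap
        (gaussianFamily presentedAlgebra (relationIdeal.mkQ freeGen) p)
      = gaussianFamily gaussianAlgebra unitGaussian p := by
  rw [HeisenbergTwainHom.map_gaussianFamily, presentedToGaussian_gen]

theorem presentedToGaussian_injective : Function.Injective presentedToGaussian.toLinearMap := by
  refine LinearMap.injective_of_linearIndependent span_gaussianFamily_presentedAlgebra ?_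
  rw [show presentedToGaussian.toLinearMap ∘ gaussianFamily presentedAlgebra _ = _ from
    funext presentedToGaussian_gaussianFamily]
  exact linearIndependent_gaussianFamily

theorem presentedToGaussian_surjective : Function.Surjective presentedToGaussian.toLinearMap := by
  -- The range is pushed forward into all functions $\mathbb{R}\to\mathbb{C}$, where $\mathcal G$ is
  -- defined as a span, so it suffices to reach each $e_\alpha g_{\mu,\rho}$.
  have h : gaussianClosure
      ≤ (LinearMap.range presentedToGaussian.toLinearMap).map gaussianClosure.subtype := by
    refine Submodule.span_le.2 ?_
    rintro _ ⟨α, μ, ρ, hρ, rfl⟩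
    exact ⟨_, ⟨_, presentedToGaussian_gaussianFamily ⟨(α, μ, ρ), hρ⟩⟩, coe_gaussianFamily _⟩
  intro f
  obtain ⟨f', ⟨a, ha⟩, hf⟩ := h f.2
  exact ⟨a, ha.trans (Subtype.ext hf)⟩

theorem HeisenbergTwainEquiv.ext_toLinearEquiv {Γ G T K A B : Type*} [AddCommGroup Γ]
    [AddCommGroup G] [CommGroup T] [CommRing K] {β : Duality Γ G T} {ε : T →* K} [AddCommGroup A]
    [Module K A] [AddCommGroup B] [Module K B] {𝒜 : HeisenbergTwainAlgebra β ε A}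
    {ℬ : HeisenbergTwainAlgebra β ε B} {e f : HeisenbergTwainEquiv 𝒜 ℬ}
    (h : e.toLinearEquiv = f.toLinearEquiv) : e = f := by
  cases e
  cases f
  cases h
  rfl

/-- An isomorphism `𝒢 → 𝔗(u) / ⟨ℛ_u⟩` that sends the unit Gaussian to the class of `u` is inverse
to `presentedToGaussian`. -/
theorem apply_presentedToGaussian (Φ : HeisenbergTwainEquiv gaussianAlgebra presentedAlgebra)
    (hΦ : Φ.toLinearEquiv unitGaussian = relationIdeal.mkQ freeGen)
    (a : FreeTwain ratDuality ratTorusAction Unit ⧸ relationIdeal) :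
    Φ.toLinearEquiv (presentedToGaussian.toLinearMap a) = a := by
  obtain ⟨s, rfl⟩ := relationIdeal.mkQ_surjective a
  -- On the class of `s`, `presentedToGaussian` is `freeToGaussian s` by definition. Its composite
  -- with `Φ` and the quotient projection are homomorphisms out of the free algebra that agree on
  -- $u$.
  exact FreeTwain.hom_ext (freeToGaussian.compEquiv Φ)
    (freeOne.quotientHom relationIdeal (freeOne.isIdeal_idealSpan _)) (fun _ => hΦ) s

end HeisTwain

theorem mainTheorem1 :
    ∃! Φ : HeisTwain.HeisenbergTwainEquiv HeisTwain.gaussianAlgebra HeisTwain.presentedAlgebra,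
      Φ.toLinearEquiv HeisTwain.unitGaussian
        = HeisTwain.relationIdeal.mkQ HeisTwain.freeGen := by
  have hb : Function.Bijective HeisTwain.presentedToGaussian.toLinearMap :=
    ⟨HeisTwain.presentedToGaussian_injective, HeisTwain.presentedToGaussian_surjective⟩
  refine ⟨HeisTwain.presentedToGaussian.symmOfBijective hb, ?_, fun Φ hΦ => ?_⟩
  · exact (LinearEquiv.symm_apply_eq (LinearEquiv.ofBijective _ hb)).2
      HeisTwain.presentedToGaussian_gen.symm
  · apply HeisTwain.HeisenbergTwainEquiv.ext_toLinearEquiv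
    ext f
    -- Every element of $\mathcal G$ is the image of some `a`, and both isomorphisms must send that
    -- image back to `a`.
    obtain ⟨a, rfl⟩ := hb.2 f
    rw [HeisTwain.apply_presentedToGaussian Φ hΦ]
    exact ((LinearEquiv.ofBijective _ hb).symm_apply_apply a).symm
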